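/- Let $\log$ be the logarithm to base 2 and let $\mathcal H_{AB}=\mathcal H_A\otimes\mathcal H_B$ be finite-dimensional. Let $n\ge 1$, let $\rho_1,\dots,\rho_n$ be density operators on $\mathcal H_{AB}$ (not necessarily identical), and write $\rho_{A_i}=\mathrm{Tr}_B\,\rho_i$, $\rho_{B_i}=\mathrm{Tr}_A\,\rho_i$. Definitions. $\mathrm H(\rho)=-\mathrm{Tr}(\rho\log\rho)$ and $\mathrm H(A_i|B_i)=\mathrm H(\rho_i)-\mathrm H(\rho_{B_i})$. For a positive semidefinite operator $\tau_{AB}$, $$\mathrm H_{\min}(A|B)_\tau=-\log\min\{\mathrm{Tr}\,\sigma_B : \sigma_B\ge 0,\ \tau_{AB}\le \mathrm{id}_A\otimes\sigma_B\}$$ (equal to $+\infty$ if $\tau=0$), and for a density operator $\rho$, $\mathrm H_{\min}^{\varepsilon}(A|B)_\rho$ is the supremum of $\mathrm H_{\min}(A|B)_\tau$ over all $\tau\ge 0$ with $\mathrm{Tr}\,\tau\le 1$ and $\sqrt{1-F(\rho,\tau)^2}\le\varepsilon$, where $F(\rho,\tau)=\|\sqrt\rho\sqrt\tau\|_1$.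 For each $i$ let $X_i=\rho_i\otimes(\mathrm{id}_A\otimes\rho_{B_i}^{-1})^{T}$ on $\mathcal H_{AB}\otimes\mathcal H_{AB}$, let $|\phi_i\rangle=(\sqrt{\rho_i}\otimes\mathrm{id})\sum_k|k\rangle\otimes|k\rangle$ (with inverses taken on supports), and $$\gamma_i=\langle\phi_i|\sqrt{X_i}+1/\sqrt{X_i}+\mathrm{id}|\phi_i\rangle .$$ Theorem. Let $\varepsilon>0$ with $n\ge\frac85\log\frac{2}{\varepsilon^2}$, and let $\gamma=\max_i\gamma_i$. Then $$\mathrm H_{\min}^{\varepsilon}(A^n|B^n)_{\rho_1\otimes\cdots\otimes\rho_n}\ \ge\ \sum_{i=1}^n \mathrm H(A_i|B_i)_{\rho_i}-\delta(\varepsilon,\gamma)\sqrt n,\qquad \delta(\varepsilon,\gamma)=4\log\gamma\,\sqrt{\log\tfrac{2}{\varepsilon^2}},$$ and the single-system entropy contribution $\gamma$ satisfies $$\gamma\ \le\ 2\max_i\sqrt{\mathrm{rank}(\rho_{A_i})}+1 .$$ (If $\varepsilon>\sqrt2$, the square root in $\delta$ is read as $0$.) -/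

import Mathlib

open scoped Kronecker ComplexOrder

noncomputable section

namespace QEntropy

/-! Finite-dimensional quantum systems. The system `A` is the Hilbert space with orthonormal basis
indexed by the finite type `a`, and `AB` is the tensor product, with basis indexed by `a × b`;
operators are complex matrices. A function of a Hermitian operator is taken by the continuous
functional calculus `cfc`, that is, on its eigenvalues. -/

/-- `ρ` is a density operator: positive semidefinite of trace one. -/
def IsDensity {m : Type*} [Fintype m] (ρ : Matrix m m ℂ) : Prop :=
  ρ.PosSemidef ∧ ρ.trace = 1

/-- The reduced operator `ρ_A = Tr_B ρ_AB`. -/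
def reduceA {a b : Type*} [Fintype b] (ρ : Matrix (a × b) (a × b) ℂ) : Matrix a a ℂ :=
  Matrix.of fun i j => ∑ k, ρ (i, k) (j, k)

/-- The reduced operator `ρ_B = Tr_A ρ_AB`. -/
def reduceB {a b : Type*} [Fintype a] (ρ : Matrix (a × b) (a × b) ℂ) : Matrix b b ℂ :=
  Matrix.of fun i j => ∑ k, ρ (k, i) (k, j)

/-- The product `ρ_1 ⊗ ⋯ ⊗ ρ_n`, regarded as an operator on `AⁿBⁿ`. -/
def productState {a b : Type*} {n : ℕ} (ρ : Fin n → Matrix (a × b) (a × b) ℂ) :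
    Matrix ((Fin n → a) × (Fin n → b)) ((Fin n → a) × (Fin n → b)) ℂ :=
  Matrix.of fun x y => ∏ i, ρ i (x.1 i, x.2 i) (y.1 i, y.2 i)

section Distance

variable {m : Type*} [Fintype m] [DecidableEq m]

/-- The square root of a positive semidefinite operator. -/
def msqrt (M : Matrix m m ℂ) : Matrix m m ℂ :=
  cfc Real.sqrt M

/-- The trace norm `‖M‖₁ = Tr √(M† M)`. -/
def traceNorm (M : Matrix m m ℂ) : ℝ :=
  (msqrt (M.conjTranspose * M)).trace.re

/-- The fidelity `F(ρ, σ) = ‖√ρ √σ‖₁`. -/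
def fidelity (ρ σ : Matrix m m ℂ) : ℝ :=
  traceNorm (msqrt ρ * msqrt σ)

/-- The distance `C(ρ, σ) = √(1 - F(ρ, σ)²)`. -/
def cDist (ρ σ : Matrix m m ℂ) : ℝ :=
  Real.sqrt (1 - fidelity ρ σ ^ 2)

/-- The positive semidefinite operators of trace at most one at distance at most `ε` from `ρ`. -/
def smoothingBall (ε : ℝ) (ρ : Matrix m m ℂ) : Set (Matrix m m ℂ) :=
  {τ | τ.PosSemidef ∧ cDist ρ τ ≤ ε ∧ τ.trace.re ≤ 1}

/-- The von Neumann entropy `-Tr (ρ log₂ ρ)`, in bits, with `0 log₂ 0 = 0`. -/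
def entropy (ρ : Matrix m m ℂ) : ℝ :=
  -(ρ * cfc (Real.logb 2) ρ).trace.re

end Distance

/-- The binary logarithm of a nonnegative real number, with the value `-∞` at `0`. -/
def elog2 (x : ℝ) : EReal :=
  if x = 0 then ⊥ else (Real.logb 2 x : EReal)

section Bipartite

variable {a b : Type*} [Fintype a] [DecidableEq a] [Fintype b] [DecidableEq b]

/-- The conditional von Neumann entropy `H(A|B) = H(ρ_AB) - H(ρ_B)`. -/
def condEntropy (ρ : Matrix (a × b) (a × b) ℂ) : ℝ :=
  entropy ρ - entropy (reduceB ρ)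

/-- The traces `Tr σ_B` of the positive semidefinite `σ_B` with `ρ_AB ≤ id_A ⊗ σ_B`. -/
def minEntropyValues (ρ : Matrix (a × b) (a × b) ℂ) : Set ℝ :=
  {t | ∃ σ : Matrix b b ℂ, σ.PosSemidef ∧
    ((1 : Matrix a a ℂ) ⊗ₖ σ - ρ).PosSemidef ∧ t = σ.trace.re}

/-- The conditional min-entropy `-log₂ min {Tr σ_B | σ_B ≥ 0, ρ_AB ≤ id_A ⊗ σ_B}`; it is `+∞` for
`ρ_AB = 0`. -/
def minEntropy (ρ : Matrix (a × b) (a × b) ℂ) : EReal :=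
  -elog2 (sInf (minEntropyValues ρ))

/-- The `ε`-smooth conditional min-entropy. -/
def smoothMinEntropy (ε : ℝ) (ρ : Matrix (a × b) (a × b) ℂ) : EReal :=
  ⨆ τ ∈ smoothingBall ε ρ, minEntropy τ

/-- The operator `X = ρ_AB ⊗ (id_A ⊗ ρ_B⁻¹)ᵀ` on two copies of `AB`, where `ρ_B⁻¹` is the inverse
on the support of `ρ_B`, and zero on its kernel. -/
def relOp (ρ : Matrix (a × b) (a × b) ℂ) :
    Matrix ((a × b) × (a × b)) ((a × b) × (a × b)) ℂ :=
  ρ ⊗ₖ ((1 : Matrix a a ℂ) ⊗ₖ cfc (fun t : ℝ => t⁻¹) (reduceB ρ)).transpose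

/-- The purification `|φ⟩ = (√ρ_AB ⊗ id) ∑ᵢ |i⟩ ⊗ |i⟩` of `ρ_AB`; its coordinate at `(p, q)` is
`⟨p| √ρ_AB |q⟩`. -/
def purification (ρ : Matrix (a × b) (a × b) ℂ) : (a × b) × (a × b) → ℂ :=
  Matrix.mulVec (msqrt ρ ⊗ₖ (1 : Matrix (a × b) (a × b) ℂ))
    (fun x => if x.1 = x.2 then 1 else 0)

/-- The single-system entropy contribution `⟨φ| √X + 1/√X + id |φ⟩`, with `1/√X` the inverse on the
support of `X` (which contains `φ`). -/
def entropyContribution (ρ : Matrix (a × b) (a × b) ℂ) : ℝ :=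
  (star (purification ρ) ⬝ᵥ
    Matrix.mulVec (cfc (fun t : ℝ => Real.sqrt t + (Real.sqrt t)⁻¹ + 1) (relOp ρ))
      (purification ρ)).re

end Bipartite

/-- The error term `δ(ε, γ) = 4 log₂ γ √(log₂ (2 / ε²))`. -/
def aepError (ε γ : ℝ) : ℝ :=
  4 * Real.logb 2 γ * Real.sqrt (Real.logb 2 (2 / ε ^ 2))

end QEntropy

end

open scoped Kronecker ComplexOrder

namespace QEntropy

open Matrix

/-! ### Diagonalisation, functional calculus and fidelity -/

section Spectral

variable {m : Type*} [Fintype m] [DecidableEq m]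

/-! The statement reduces to a classical one about a single random variable. Diagonalise `ρ` with
eigenpairs `(r_i, v_i)` and `id_A ⊗ ρ_B` with eigenpairs `(s_j, w_j)`, and let the pair `(i, j)`
have probability `r_i |⟨w_j|v_i⟩|²`. Put `x = r_i / s_j`. The `x` are the eigenvalues of `X`, and
this law is the spectral distribution of `X` in the state `φ`. Hence `γ_i = E[√x + 1/√x + 1]`
(`SpectralData.entropyContribution_eq`) and `H(A|B) = -E[log x]` (`SpectralData.condEntropy_eq`).
For product states the law is a product and `x` multiplies.

The quantum step is `exists_le_conjDiag_fidelity`. Given `Λ`, it builds a subnormalized `τ ≤ Λ`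
whose infidelity with `ρ` is at most the expectation of `r/(s + r)`. The construction multiplies the
matrix of overlaps entrywise by `√s √r/(s + r)`, which leaves a contraction. With `Λ = l · id ⊗ ρ_B`
the integrand is at most `(x/l)^t`, so a Chernoff-type bound on `E[x^t]`, multiplicative over the
systems, shows that `τ` lies in the smoothing ball; its min-entropy is at least `-log l`.

The moment bound `sum_mul_rpow_le_exp` reads `E[x^t] ≤ exp(t E[log x] + O((t log γ)²))`. It comes
from `x^t ≤ 1 + t log x + 2(cosh(t log x) - 1)` and Jensen's inequality for `cosh(2t log y)` with `y
= √x + 1/√x + 1`. Taking `t` of order `√(L/n)/log γ`, where `L = log(2/ε²)`, gives the error term.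

The rank bound follows from `E[x] ≤ rank ρ_A` and `E[1/x] ≤ rank ρ_A` by Cauchy–Schwarz. -/

/-- The operator with eigenvalues `d` and eigenvectors the columns of `V`. -/
noncomputable def conjDiag (V : Matrix m m ℂ) (d : m → ℝ) : Matrix m m ℂ :=
  V * diagonal (fun i => (d i : ℂ)) * Vᴴ

lemma conjDiag_apply (V : Matrix m m ℂ) (d : m → ℝ) (i j : m) :
    conjDiag V d i j = ∑ k, V i k * d k * star (V j k) := by
  rw [conjDiag, Matrix.mul_apply]
  simp [Matrix.mul_diagonal]

lemma isHermitian_conjDiag (V : Matrix m m ℂ) (d : m → ℝ) : (conjDiag V d).IsHermitian := by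
  have hd : (diagonal (fun i => (d i : ℂ))).IsHermitian := by
    rw [Matrix.IsHermitian, diagonal_conjTranspose]
    congr 1
    ext i
    simp
  exact isHermitian_mul_mul_conjTranspose V hd

lemma posSemidef_conjDiag (V : Matrix m m ℂ) {d : m → ℝ} (hd : ∀ i, 0 ≤ d i) :
    (conjDiag V d).PosSemidef := by
  refine PosSemidef.mul_mul_conjTranspose_same (posSemidef_diagonal_iff.2 fun i => ?_) V
  exact_mod_cast hd i

lemma trace_conjDiag {V : Matrix m m ℂ} (hV : Vᴴ * V = 1) (d : m → ℝ) :
    (conjDiag V d).trace = ∑ i, (d i : ℂ) := by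
  rw [conjDiag, trace_mul_comm, ← Matrix.mul_assoc, hV, Matrix.one_mul, trace_diagonal]

lemma conjDiag_mul_conjDiag {V : Matrix m m ℂ} (hV : Vᴴ * V = 1) (d e : m → ℝ) :
    conjDiag V d * conjDiag V e = conjDiag V (fun i => d i * e i) := by
  calc conjDiag V d * conjDiag V e
      = V * diagonal (fun i => (d i : ℂ)) * (Vᴴ * V) * diagonal (fun i => (e i : ℂ)) * Vᴴ := by
        simp only [conjDiag, Matrix.mul_assoc]
    _ = _ := by
        rw [hV, Matrix.mul_one, Matrix.mul_assoc V, diagonal_mul_diagonal, conjDiag]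
        simp

lemma conjTranspose_mul_conjDiag_mul {V : Matrix m m ℂ} (hV : Vᴴ * V = 1) (d : m → ℝ) :
    Vᴴ * conjDiag V d * V = diagonal (fun i => (d i : ℂ)) := by
  calc Vᴴ * conjDiag V d * V = (Vᴴ * V) * diagonal (fun i => (d i : ℂ)) * (Vᴴ * V) := by
        simp only [conjDiag, Matrix.mul_assoc]
    _ = _ := by rw [hV, Matrix.one_mul, Matrix.mul_one]

lemma exists_eq_conjDiag {A : Matrix m m ℂ} (hA : A.IsHermitian) :
    (hA.eigenvectorUnitary : Matrix m m ℂ)ᴴ * (hA.eigenvectorUnitary : Matrix m m ℂ) = 1 ∧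
      A = conjDiag (hA.eigenvectorUnitary : Matrix m m ℂ) hA.eigenvalues := by
  refine ⟨Unitary.coe_star_mul_self hA.eigenvectorUnitary, ?_⟩
  conv_lhs => rw [hA.spectral_theorem, Unitary.conjStarAlgAut_apply]
  rfl

/-- The functional calculus does not depend on the chosen eigenbasis. The change of basis `Uᴴ * V`
intertwines the two diagonal matrices, so its entries vanish unless the eigenvalues agree; it
therefore also intertwines their images under any `f`, continuous or not. -/
lemma cfc_conjDiag {V : Matrix m m ℂ} (hV : Vᴴ * V = 1) (d : m → ℝ) (f : ℝ → ℝ) :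
    cfc f (conjDiag V d) = conjDiag V (fun i => f (d i)) := by
  have hA := isHermitian_conjDiag V d
  obtain ⟨hU, hUA⟩ := exists_eq_conjDiag hA
  have hcfc : cfc f (conjDiag V d) =
      conjDiag (hA.eigenvectorUnitary : Matrix m m ℂ) (fun i => f (hA.eigenvalues i)) := by
    rw [hA.cfc_eq, Matrix.IsHermitian.cfc, Unitary.conjStarAlgAut_apply]
    rfl
  rw [hcfc]
  set U := (hA.eigenvectorUnitary : Matrix m m ℂ)
  set l := hA.eigenvalues
  have hV' : V * Vᴴ = 1 := mul_eq_one_comm.1 hV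
  have hU' : U * Uᴴ = 1 := mul_eq_one_comm.1 hU
  have key : diagonal (fun i => (l i : ℂ)) * (Uᴴ * V) = (Uᴴ * V) * diagonal (fun i => (d i : ℂ)) := by
    calc diagonal (fun i => (l i : ℂ)) * (Uᴴ * V)
        = (Uᴴ * U) * diagonal (fun i => (l i : ℂ)) * Uᴴ * V := by
          rw [hU, Matrix.one_mul, Matrix.mul_assoc]
      _ = Uᴴ * conjDiag U l * V := by simp only [conjDiag, Matrix.mul_assoc]
      _ = Uᴴ * conjDiag V d * V := by rw [← hUA]
      _ = (Uᴴ * V) * diagonal (fun i => (d i : ℂ)) * (Vᴴ * V) := by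
          simp only [conjDiag, Matrix.mul_assoc]
      _ = _ := by rw [hV, Matrix.mul_one]
  have key' : diagonal (fun i => (f (l i) : ℂ)) * (Uᴴ * V) =
      (Uᴴ * V) * diagonal (fun i => (f (d i) : ℂ)) := by
    ext i j
    have h := congrFun (congrFun key i) j
    rw [diagonal_mul, mul_diagonal] at h ⊢
    by_cases h0 : (Uᴴ * V) i j = 0
    · simp [h0]
    · have : (l i : ℂ) = d j := by
        rw [mul_comm] at h
        exact mul_left_cancel₀ h0 h
      rw [show l i = d j by exact_mod_cast this, mul_comm]
  calc conjDiag U (fun i => f (l i))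
      = U * (diagonal (fun i => (f (l i) : ℂ)) * (Uᴴ * V)) * Vᴴ := by
        rw [conjDiag, ← Matrix.mul_assoc, ← Matrix.mul_assoc, Matrix.mul_assoc _ V, hV',
          Matrix.mul_one]
    _ = (U * Uᴴ) * V * diagonal (fun i => (f (d i) : ℂ)) * Vᴴ := by
        rw [key']; simp only [Matrix.mul_assoc]
    _ = _ := by rw [hU', Matrix.one_mul, conjDiag]

lemma msqrt_conjDiag {V : Matrix m m ℂ} (hV : Vᴴ * V = 1) (d : m → ℝ) :
    msqrt (conjDiag V d) = conjDiag V (fun i => Real.sqrt (d i)) :=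
  cfc_conjDiag hV d _

/-- `Nᴴ * N` and `N * Nᴴ` have the same characteristic polynomial, hence the same eigenvalues with
multiplicity. -/
lemma trace_cfc_mul_conjTranspose_comm (N : Matrix m m ℂ) (f : ℝ → ℝ) :
    (cfc f (Nᴴ * N)).trace = (cfc f (N * Nᴴ)).trace := by
  have h1 := (posSemidef_conjTranspose_mul_self N).isHermitian
  have h2 := (posSemidef_self_mul_conjTranspose N).isHermitian
  have h := (h1.eigenvalues_eq_eigenvalues_iff h2).2 (charpoly_mul_comm _ _)
  rw [trace_eq_sum_roots_charpoly, trace_eq_sum_roots_charpoly, h1.charpoly_cfc_eq,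
    h2.charpoly_cfc_eq, h]

lemma traceNorm_conjTranspose (N : Matrix m m ℂ) : traceNorm Nᴴ = traceNorm N := by
  rw [traceNorm, traceNorm, msqrt, msqrt, trace_cfc_mul_conjTranspose_comm N,
    conjTranspose_conjTranspose]

/-- In an eigenbasis of `Zᴴ * Z`, each diagonal entry of `Z` is bounded by the norm of its column,
which is a singular value. -/
lemma re_trace_le_traceNorm (Z : Matrix m m ℂ) : Z.trace.re ≤ traceNorm Z := by
  have hA := (posSemidef_conjTranspose_mul_self Z).isHermitian
  obtain ⟨hU, hUA⟩ := exists_eq_conjDiag hA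
  set U := (hA.eigenvectorUnitary : Matrix m m ℂ)
  set l := hA.eigenvalues
  have hU' : U * Uᴴ = 1 := mul_eq_one_comm.1 hU
  rw [traceNorm, hUA, msqrt_conjDiag hU, trace_conjDiag hU]
  set Y := Uᴴ * Z * U with hY
  have hYY : Yᴴ * Y = diagonal (fun i => (l i : ℂ)) := by
    rw [← conjTranspose_mul_conjDiag_mul hU, ← hUA]
    calc Yᴴ * Y = Uᴴ * Zᴴ * (U * Uᴴ) * Z * U := by
          simp only [hY, conjTranspose_mul, conjTranspose_conjTranspose, Matrix.mul_assoc]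
      _ = _ := by rw [hU', Matrix.mul_one]; simp only [Matrix.mul_assoc]
  have htr : Z.trace = Y.trace := by
    rw [hY, trace_mul_comm, ← Matrix.mul_assoc, hU', Matrix.one_mul]
  rw [htr, Matrix.trace, Complex.re_sum, Complex.re_sum]
  refine Finset.sum_le_sum fun k _ => ?_
  rw [Complex.ofReal_re, diag_apply]
  apply Real.le_sqrt_of_sq_le
  have h := congrArg Complex.re (congrFun (congrFun hYY k) k)
  rw [diagonal_apply_eq, Complex.ofReal_re, Matrix.mul_apply, Complex.re_sum] at h
  rw [← h]
  have hterm : ∀ j, (Yᴴ k j * Y j k).re = Complex.normSq (Y j k) := fun j => by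
    rw [conjTranspose_apply, Complex.star_def, ← Complex.normSq_eq_conj_mul_self, Complex.ofReal_re]
  calc (Y k k).re ^ 2 ≤ Complex.normSq (Y k k) := by
        rw [Complex.normSq_apply]; nlinarith [mul_self_nonneg (Y k k).im]
    _ ≤ ∑ j, Complex.normSq (Y j k) :=
        Finset.single_le_sum (f := fun j => Complex.normSq (Y j k))
          (fun j _ => Complex.normSq_nonneg _) (Finset.mem_univ k)
    _ = _ := Finset.sum_congr rfl fun j _ => (hterm j).symm

/-- The fidelity of `ρ` with `T T†` is at least the overlap `Re Tr (√ρ T)`. -/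
lemma re_trace_msqrt_mul_le_fidelity {ρ : Matrix m m ℂ} (hρ : ρ.PosSemidef) (T : Matrix m m ℂ) :
    (msqrt ρ * T).trace.re ≤ fidelity ρ (T * Tᴴ) := by
  have hsq : ∀ {A : Matrix m m ℂ}, A.PosSemidef → (msqrt A)ᴴ = msqrt A ∧ msqrt A * msqrt A = A := by
    intro A hA
    obtain ⟨hU, hUA⟩ := exists_eq_conjDiag hA.isHermitian
    have h0 := hA.eigenvalues_nonneg
    set l := hA.isHermitian.eigenvalues
    rw [hUA, msqrt_conjDiag hU, conjDiag_mul_conjDiag hU]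
    refine ⟨isHermitian_conjDiag _ _, ?_⟩
    simp_rw [Real.mul_self_sqrt (h0 _)]
  obtain ⟨h1, -⟩ := hsq hρ
  obtain ⟨h2, h3⟩ := hsq (posSemidef_self_mul_conjTranspose T)
  -- Passing to adjoints, both trace norms are the trace of the square root of `√ρ T Tᴴ √ρ`.
  have h4 : fidelity ρ (T * Tᴴ) = traceNorm (msqrt ρ * T) := by
    rw [fidelity, ← traceNorm_conjTranspose (_ * _), ← traceNorm_conjTranspose (_ * T), traceNorm,
      traceNorm, conjTranspose_conjTranspose, conjTranspose_conjTranspose, conjTranspose_mul,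
      conjTranspose_mul, h2, Matrix.mul_assoc, ← Matrix.mul_assoc (msqrt (T * Tᴴ)), h3]
    simp only [Matrix.mul_assoc]
  rw [h4]
  exact re_trace_le_traceNorm _

end Spectral

/-! ### Transition probabilities and the one-shot smoothing operator -/

section Overlap

variable {m : Type*} [Fintype m]

/-- The transition probabilities `|⟨w_j|v_i⟩|²` between the columns of `V` and of `W`. -/
def overlap (V W : Matrix m m ℂ) (i j : m) : ℝ :=
  Complex.normSq ((Wᴴ * V) j i)

lemma overlap_nonneg (V W : Matrix m m ℂ) (i j : m) : 0 ≤ overlap V W i j :=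
  Complex.normSq_nonneg _

lemma overlap_comm (V W : Matrix m m ℂ) (i j : m) : overlap V W i j = overlap W V j i := by
  rw [overlap, overlap, ← Complex.normSq_conj, ← Complex.star_def, ← conjTranspose_apply,
    conjTranspose_mul, conjTranspose_conjTranspose]

end Overlap

section OneShot

variable {m : Type*} [Fintype m] [DecidableEq m]

lemma sum_normSq_mulVec {U : Matrix m m ℂ} (hU : Uᴴ * U = 1) (q : m → ℂ) :
    ∑ j, Complex.normSq ((U *ᵥ q) j) = ∑ i, Complex.normSq (q i) := by
  have h : ∀ v : m → ℂ, ((∑ i, Complex.normSq (v i) : ℝ) : ℂ) = star v ⬝ᵥ v := fun v => by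
    simp [dotProduct, Complex.normSq_eq_conj_mul_self]
  apply Complex.ofReal_injective
  rw [h, h, star_mulVec, ← dotProduct_mulVec, mulVec_mulVec, hU, one_mulVec]

/-- The arithmetic-geometric mean inequality for operators: a Schur multiple of an isometry by the
kernel `c d / (c² + d²)` is a contraction. -/
lemma posSemidef_one_sub_of_amgm_kernel {U M : Matrix m m ℂ} (hU : Uᴴ * U = 1) {c d : m → ℝ}
    (hM : ∀ j i, ((c j ^ 2 + d i ^ 2 : ℝ) : ℂ) * M j i = c j * d i * U j i)
    (hM0 : ∀ j i, c j = 0 → M j i = 0) : (1 - M * Mᴴ).PosSemidef := by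
  have hH : (1 - M * Mᴴ).IsHermitian :=
    isHermitian_one.sub (posSemidef_self_mul_conjTranspose M).isHermitian
  -- Suppose `1 - M Mᴴ` has an eigenvalue `h < 0` with eigenvector `w`, and put `v = Mᴴ w`, `p = c
  -- w`, `q = d v`. The kernel identity gives `⟨p, U q⟩ = (1 - h)‖p‖² + ‖q‖²`, while Cauchy–Schwarz
  -- and AM-GM give real part at most `(‖p‖² + ‖q‖²)/2`. So `p = 0`, which forces `v = 0` and `w =
  -- 0`.
  rw [hH.posSemidef_iff_eigenvalues_nonneg]
  intro k
  by_contra! hk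
  rw [Pi.zero_apply] at hk
  set h := hH.eigenvalues k
  set w : m → ℂ := ⇑(hH.eigenvectorBasis k)
  have hw : (1 - M * Mᴴ) *ᵥ w = (h : ℂ) • w := hH.mulVec_eigenvectorBasis k
  set v : m → ℂ := Mᴴ *ᵥ w with hv
  have hMv : ∀ j, (M *ᵥ v) j = ((1 - h : ℝ) : ℂ) * w j := fun j => by
    have := congrFun hw j
    rw [sub_mulVec, one_mulVec, ← mulVec_mulVec] at this
    simp only [Pi.sub_apply, Pi.smul_apply, smul_eq_mul] at this
    push_cast
    linear_combination -this
  set p : m → ℂ := fun j => c j * w j with hp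
  set q : m → ℂ := fun i => d i * v i with hq
  have hv' : ∀ i, ∑ j, star (w j) * M j i = star (v i) := fun i => by
    simp [hv, mulVec, dotProduct, mul_comm]
  have hS : star p ⬝ᵥ (U *ᵥ q) = (((1 - h) * ∑ j, Complex.normSq (p j)
      + ∑ i, Complex.normSq (q i) : ℝ) : ℂ) := by
    have e1 : star p ⬝ᵥ (U *ᵥ q) = ∑ j, ∑ i, (star (w j) * (c j : ℂ) ^ 2 * (M j i * v i)
        + (d i : ℂ) ^ 2 * v i * (star (w j) * M j i)) := by
      simp only [dotProduct, mulVec, Finset.mul_sum]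
      refine Finset.sum_congr rfl fun j _ => Finset.sum_congr rfl fun i _ => ?_
      have := hM j i
      push_cast at this
      simp only [hp, hq, Pi.star_apply, star_mul', Complex.star_def, Complex.conj_ofReal]
      linear_combination (-(starRingEnd ℂ) (w j) * v i) * this
    rw [e1]
    simp only [Finset.sum_add_distrib]
    rw [Finset.sum_comm (f := fun j i => (d i : ℂ) ^ 2 * v i * (star (w j) * M j i))]
    simp only [← Finset.mul_sum, hv']
    have e2 : ∀ j, ∑ i, M j i * v i = ((1 - h : ℝ) : ℂ) * w j := hMv
    simp only [e2]
    push_cast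
    rw [Finset.mul_sum]
    congr 1 <;> refine Finset.sum_congr rfl fun j _ => ?_
    · rw [Complex.normSq_eq_conj_mul_self]
      simp only [hp, map_mul, Complex.conj_ofReal, Complex.star_def]
      ring
    · rw [Complex.normSq_eq_conj_mul_self]
      simp only [hq, map_mul, Complex.conj_ofReal, Complex.star_def]
      ring
  have hre : (star p ⬝ᵥ (U *ᵥ q)).re ≤
      (∑ j, Complex.normSq (p j) + ∑ i, Complex.normSq (q i)) / 2 := by
    rw [← sum_normSq_mulVec hU q, dotProduct, Complex.re_sum, ← Finset.sum_add_distrib,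
      Finset.sum_div]
    refine Finset.sum_le_sum fun j _ => ?_
    simp only [Pi.star_apply, Complex.star_def, Complex.mul_re, Complex.conj_re, Complex.conj_im,
      Complex.normSq_apply]
    nlinarith [sq_nonneg ((p j).re - ((U *ᵥ q) j).re), sq_nonneg ((p j).im - ((U *ᵥ q) j).im)]
  rw [hS, Complex.ofReal_re] at hre
  have hP : 0 ≤ ∑ j, Complex.normSq (p j) := Finset.sum_nonneg fun _ _ => Complex.normSq_nonneg _
  have hQ : 0 ≤ ∑ i, Complex.normSq (q i) := Finset.sum_nonneg fun _ _ => Complex.normSq_nonneg _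
  have hP0 : ∑ j, Complex.normSq (p j) = 0 := by nlinarith
  have hp0 : ∀ j, p j = 0 := fun j => by
    have := (Finset.sum_eq_zero_iff_of_nonneg fun _ _ => Complex.normSq_nonneg _).1 hP0 j
      (Finset.mem_univ j)
    exact Complex.normSq_eq_zero.1 this
  have hw0 : w = 0 := by
    have hv0 : v = 0 := by
      ext i
      simp only [hv, mulVec, dotProduct, conjTranspose_apply, Pi.zero_apply]
      refine Finset.sum_eq_zero fun j _ => ?_
      rcases mul_eq_zero.1 (hp0 j) with h0 | h0
      · rw [hM0 j i (by exact_mod_cast h0)]; simp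
      · rw [h0, mul_zero]
    ext j
    have := hMv j
    rw [hv0, mulVec_zero, Pi.zero_apply] at this
    have h1 : ((1 - h : ℝ) : ℂ) ≠ 0 := by
      exact_mod_cast (by linarith : (1 - h : ℝ) ≠ 0)
    exact (mul_eq_zero.1 this.symm).resolve_left h1
  have hnorm := hH.eigenvectorBasis.orthonormal.1 k
  have : (hH.eigenvectorBasis k : EuclideanSpace ℂ m) = 0 := by
    ext j
    exact congrFun hw0 j
  rw [this, norm_zero] at hnorm
  exact zero_ne_one hnorm

lemma sum_normSq_col {U : Matrix m m ℂ} (hU : Uᴴ * U = 1) (i : m) :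
    ∑ j, Complex.normSq (U j i) = 1 := by
  have h := congrArg Complex.re (congrFun (congrFun hU i) i)
  rw [Matrix.mul_apply, Complex.re_sum, one_apply_eq, Complex.one_re] at h
  rw [← h]
  refine Finset.sum_congr rfl fun j _ => ?_
  rw [conjTranspose_apply, Complex.star_def, ← Complex.normSq_eq_conj_mul_self, Complex.ofReal_re]

lemma conjTranspose_mul_isometry {V W : Matrix m m ℂ} (hV : Vᴴ * V = 1) (hW : Wᴴ * W = 1) :
    (Wᴴ * V)ᴴ * (Wᴴ * V) = 1 := by
  have hW' : W * Wᴴ = 1 := mul_eq_one_comm.1 hW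
  rw [conjTranspose_mul, conjTranspose_conjTranspose, Matrix.mul_assoc, ← Matrix.mul_assoc W, hW',
    Matrix.one_mul, hV]

lemma sum_overlap {V W : Matrix m m ℂ} (hV : Vᴴ * V = 1) (hW : Wᴴ * W = 1) (i : m) :
    ∑ j, overlap V W i j = 1 :=
  sum_normSq_col (conjTranspose_mul_isometry hV hW) i

/-- Given spectral decompositions of `ρ` and `Λ`, there is a subnormalized operator
`τ ≤ Λ` whose fidelity with `ρ` is controlled by the joint distribution of the eigenvalues. -/
theorem exists_le_conjDiag_fidelity {V W : Matrix m m ℂ} (hV : Vᴴ * V = 1) (hW : Wᴴ * W = 1)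
    {r s : m → ℝ} (hr : ∀ i, 0 ≤ r i) (hs : ∀ j, 0 ≤ s j) (hr1 : ∑ i, r i = 1) :
    ∃ τ : Matrix m m ℂ, τ.PosSemidef ∧ (conjDiag W s - τ).PosSemidef ∧ τ.trace.re ≤ 1 ∧
      1 - ∑ i, ∑ j, r i * overlap V W i j * (r i / (s j + r i)) ≤
        fidelity (conjDiag V r) τ := by
  set U := Wᴴ * V with hUdef
  have hU : Uᴴ * U = 1 := conjTranspose_mul_isometry hV hW
  -- `M` is a contraction, so with `T = √Λ` times `M` (rotated to the eigenbases) the operator `T Tᴴ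
  -- = √Λ (M Mᴴ) √Λ` lies below `Λ`. The overlap of `T` with `√ρ` is the expectation of `s/(s + r)`.
  set M : Matrix m m ℂ := of fun j i =>
    ((Real.sqrt (s j) * Real.sqrt (r i) / (s j + r i) : ℝ) : ℂ) * U j i with hMdef
  have hsr : ∀ {i j}, s j + r i = 0 → s j = 0 ∧ r i = 0 := fun {i j} h =>
    ⟨by linarith [hr i, hs j], by linarith [hr i, hs j]⟩
  have hM := posSemidef_one_sub_of_amgm_kernel (M := M) (c := fun j => Real.sqrt (s j))
    (d := fun i => Real.sqrt (r i)) hU (fun j i => by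
      rw [Real.sq_sqrt (hs j), Real.sq_sqrt (hr i), hMdef, of_apply, ← mul_assoc,
        ← Complex.ofReal_mul, ← Complex.ofReal_mul]
      congr 2
      by_cases h : s j + r i = 0
      · simp [(hsr h).1, (hsr h).2]
      · field_simp) (fun j i h => by simp [hMdef, h])
  set C : Matrix m m ℂ := diagonal (fun j => ((Real.sqrt (s j) : ℝ) : ℂ)) with hC
  have hCH : Cᴴ = C := by
    rw [hC, diagonal_conjTranspose]; congr 1; ext; simp
  have hCC : C * C = diagonal (fun j => (s j : ℂ)) := by
    rw [hC, diagonal_mul_diagonal]; congr 1; ext j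
    rw [← Complex.ofReal_mul, Real.mul_self_sqrt (hs j)]
  set T := W * C * M * Vᴴ with hT
  have hV' : V * Vᴴ = 1 := mul_eq_one_comm.1 hV
  have hTT : T * Tᴴ = (W * C) * (M * Mᴴ) * (W * C)ᴴ := by
    calc T * Tᴴ = W * C * M * (Vᴴ * V) * Mᴴ * (W * C)ᴴ := by
          simp only [hT, conjTranspose_mul, conjTranspose_conjTranspose, Matrix.mul_assoc]
      _ = _ := by rw [hV, Matrix.mul_one]; simp only [Matrix.mul_assoc]
  have hCM : ∀ j i, (C * M) j i = ((s j * Real.sqrt (r i) / (s j + r i) : ℝ) : ℂ) * U j i := by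
    intro j i
    rw [hC, diagonal_mul, hMdef, of_apply, ← mul_assoc, ← Complex.ofReal_mul]
    congr 2
    rw [← mul_div_assoc, ← mul_assoc, Real.mul_self_sqrt (hs j)]
  refine ⟨T * Tᴴ, posSemidef_self_mul_conjTranspose T, ?_, ?_, ?_⟩
  · have : conjDiag W s - T * Tᴴ = (W * C) * (1 - M * Mᴴ) * (W * C)ᴴ := by
      rw [hTT, Matrix.mul_sub, Matrix.sub_mul, Matrix.mul_one, conjTranspose_mul, hCH, conjDiag,
        ← hCC]
      simp only [Matrix.mul_assoc]
    rw [this]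
    exact hM.mul_mul_conjTranspose_same _
  · have h1 : (T * Tᴴ).trace = ((C * M) * (C * M)ᴴ).trace := by
      calc (T * Tᴴ).trace = (W * ((C * M) * (C * M)ᴴ * Wᴴ)).trace := by
            rw [hTT]; simp only [conjTranspose_mul, Matrix.mul_assoc]
        _ = _ := by rw [trace_mul_comm, Matrix.mul_assoc, hW, Matrix.mul_one]
    rw [h1, Matrix.trace, Complex.re_sum, ← hr1]
    have h2 : ∀ j, (((C * M) * (C * M)ᴴ).diag j).re =
        ∑ i, (s j * Real.sqrt (r i) / (s j + r i)) ^ 2 * overlap V W i j := by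
      intro j
      rw [diag_apply, Matrix.mul_apply, Complex.re_sum]
      refine Finset.sum_congr rfl fun i _ => ?_
      rw [conjTranspose_apply, Complex.star_def, Complex.mul_conj, Complex.ofReal_re, hCM,
        Complex.normSq_mul, Complex.normSq_ofReal, overlap, sq]
    simp only [h2]
    rw [Finset.sum_comm]
    refine Finset.sum_le_sum fun i _ => ?_
    calc ∑ j, (s j * Real.sqrt (r i) / (s j + r i)) ^ 2 * overlap V W i j
        ≤ ∑ j, r i * overlap V W i j := by
          refine Finset.sum_le_sum fun j _ => mul_le_mul_of_nonneg_right ?_ (overlap_nonneg _ _ _ _)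
          rw [mul_div_right_comm, mul_pow, Real.sq_sqrt (hr i)]
          have : s j / (s j + r i) ≤ 1 :=
            div_le_one_of_le₀ (by linarith [hr i]) (by linarith [hr i, hs j])
          have h0 : 0 ≤ s j / (s j + r i) := div_nonneg (hs j) (by linarith [hr i, hs j])
          nlinarith [hr i, mul_le_mul_of_nonneg_right (pow_le_one₀ h0 this (n := 2)) (hr i)]
      _ = r i := by rw [← Finset.mul_sum, sum_overlap hV hW, mul_one]
  · refine le_trans (le_of_eq ?_)
      (re_trace_msqrt_mul_le_fidelity (posSemidef_conjDiag V hr) T)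
    set R : Matrix m m ℂ := diagonal (fun i => ((Real.sqrt (r i) : ℝ) : ℂ)) with hR
    have h1 : (msqrt (conjDiag V r) * T).trace = (R * Uᴴ * (C * M)).trace := by
      rw [msqrt_conjDiag hV]
      calc (conjDiag V (fun i => Real.sqrt (r i)) * T).trace
          = (V * (R * Uᴴ * (C * M) * Vᴴ)).trace := by
            simp only [conjDiag, hT, hUdef, conjTranspose_mul, conjTranspose_conjTranspose,
              Matrix.mul_assoc, hR]
        _ = _ := by rw [trace_mul_comm, Matrix.mul_assoc, hV, Matrix.mul_one]
    have h2 : ∀ i, ((R * Uᴴ * (C * M)).diag i).re =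
        ∑ j, r i * overlap V W i j * (s j / (s j + r i)) := by
      intro i
      rw [diag_apply, Matrix.mul_apply, Complex.re_sum]
      refine Finset.sum_congr rfl fun j _ => ?_
      rw [hCM, hR, diagonal_mul, conjTranspose_apply, Complex.star_def]
      have : ((Real.sqrt (r i) : ℝ) : ℂ) * (starRingEnd ℂ) (U j i) *
          (((s j * Real.sqrt (r i) / (s j + r i) : ℝ) : ℂ) * U j i) =
          ((Real.sqrt (r i) * (s j * Real.sqrt (r i) / (s j + r i)) * overlap V W i j : ℝ) : ℂ) := by
        rw [overlap, ← hUdef]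
        push_cast
        rw [Complex.normSq_eq_conj_mul_self]
        ring
      rw [this, Complex.ofReal_re]
      have h3 := Real.mul_self_sqrt (hr i)
      rw [mul_div_right_comm]
      linear_combination (s j / (s j + r i) * overlap V W i j) * h3
    rw [h1, Matrix.trace, Complex.re_sum]
    simp only [h2]
    have h4 : (1 : ℝ) = ∑ i, ∑ j, r i * overlap V W i j := by
      simp only [← Finset.mul_sum, sum_overlap hV hW, mul_one, hr1]
    rw [h4, ← Finset.sum_sub_distrib]
    refine Finset.sum_congr rfl fun i _ => ?_
    rw [← Finset.sum_sub_distrib]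
    refine Finset.sum_congr rfl fun j _ => ?_
    by_cases h : s j + r i = 0
    · simp [(hsr h).2]
    · field_simp
      ring

end OneShot

/-- The expectation of `f (r_i / s_j)` for the joint distribution `r_i |⟨w_j|v_i⟩|²` of the
eigenvalues of `conjDiag V r` and `conjDiag W s`. -/
noncomputable def jointExp {m : Type*} [Fintype m] (V W : Matrix m m ℂ) (r s : m → ℝ)
    (f : ℝ → ℝ) : ℝ :=
  ∑ i, ∑ j, r i * overlap V W i j * f (r i / s j)

/-- The left side is at most `min 1 (x / y)`, and `min 1 z ≤ z ^ t` for exponents in `[0, 1]`. This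
replaces the infidelity by a moment, which factorises over independent systems. -/
lemma div_add_le_rpow_div {x y t : ℝ} (hx : 0 ≤ x) (hy : 0 < y) (ht0 : 0 ≤ t) (ht1 : t ≤ 1) :
    x / (y + x) ≤ (x / y) ^ t := by
  have h1 : x / (y + x) ≤ 1 := div_le_one_of_le₀ (by linarith) (by linarith)
  rcases le_total x y with h | h
  · have h2 : x / y ≤ 1 := div_le_one_of_le₀ h hy.le
    calc x / (y + x) ≤ x / y := div_le_div_of_nonneg_left hx hy (by linarith)
      _ = (x / y) ^ (1 : ℝ) := (Real.rpow_one _).symm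
      _ ≤ (x / y) ^ t := by
        rcases hx.eq_or_lt with rfl | hx'
        · rw [zero_div, Real.zero_rpow one_ne_zero]
          exact Real.rpow_nonneg le_rfl _
        · exact Real.rpow_le_rpow_of_exponent_ge (div_pos hx' hy) h2 ht1
  · exact h1.trans (Real.one_le_rpow ((one_le_div hy).2 h) ht0)

/-! ### Product operators and factorisation of the joint law -/

section Product

variable {a b : Type*} [Fintype a] [Fintype b] {n : ℕ}

lemma sum_prod_eq_prod_sum {R : Type*} [CommSemiring R] (f : Fin n → a × b → R) :
    ∑ z : (Fin n → a) × (Fin n → b), ∏ i, f i (z.1 i, z.2 i) = ∏ i, ∑ p, f i p := by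
  classical
  rw [Finset.prod_univ_sum, Fintype.piFinset_univ]
  exact (Fintype.sum_equiv (Equiv.arrowProdEquivProdArrow (Fin n) (fun _ => a) (fun _ => b)) _ _
    fun x => rfl).symm

lemma productState_mul (A B : Fin n → Matrix (a × b) (a × b) ℂ) :
    productState A * productState B = productState (fun i => A i * B i) := by
  ext x y
  simp only [Matrix.mul_apply, productState, of_apply, ← Finset.prod_mul_distrib]
  exact sum_prod_eq_prod_sum fun i p => A i (x.1 i, x.2 i) p * B i p (y.1 i, y.2 i)

omit [Fintype a] [Fintype b] in
lemma conjTranspose_productState (A : Fin n → Matrix (a × b) (a × b) ℂ) :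
    (productState A)ᴴ = productState (fun i => (A i)ᴴ) := by
  ext x y
  simp [productState, conjTranspose_apply]

omit [Fintype a] [Fintype b] in
lemma productState_diagonal [DecidableEq a] [DecidableEq b] (d : Fin n → a × b → ℂ) :
    productState (fun i => diagonal (d i)) =
      diagonal (fun x => ∏ i, d i (x.1 i, x.2 i)) := by
  ext x y
  rw [productState, of_apply, diagonal_apply]
  split_ifs with h
  · subst h
    simp
  · obtain ⟨i, hi⟩ : ∃ i, (x.1 i, x.2 i) ≠ (y.1 i, y.2 i) := by
      by_contra! hc
      exact h (Prod.ext (funext fun i => (Prod.ext_iff.1 (hc i)).1)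
        (funext fun i => (Prod.ext_iff.1 (hc i)).2))
    exact Finset.prod_eq_zero (Finset.mem_univ i) (diagonal_apply_ne _ hi)

omit [Fintype a] [Fintype b] in
lemma productState_one [DecidableEq a] [DecidableEq b] :
    productState (fun _ : Fin n => (1 : Matrix (a × b) (a × b) ℂ)) = 1 := by
  simp only [← diagonal_one, productState_diagonal, Finset.prod_const_one]

lemma productState_conjDiag [DecidableEq a] [DecidableEq b]
    (V : Fin n → Matrix (a × b) (a × b) ℂ) (d : Fin n → a × b → ℝ) :
    productState (fun i => conjDiag (V i) (d i)) =
      conjDiag (productState V) (fun x => ∏ i, d i (x.1 i, x.2 i)) := by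
  simp only [conjDiag, ← productState_mul, conjTranspose_productState, productState_diagonal,
    Complex.ofReal_prod]

lemma productState_isometry [DecidableEq a] [DecidableEq b]
    {V : Fin n → Matrix (a × b) (a × b) ℂ} (hV : ∀ i, (V i)ᴴ * V i = 1) :
    (productState V)ᴴ * productState V = 1 := by
  simp only [conjTranspose_productState, productState_mul, hV, productState_one]

lemma overlap_productState (V W : Fin n → Matrix (a × b) (a × b) ℂ)
    (x y : (Fin n → a) × (Fin n → b)) :
    overlap (productState V) (productState W) x y =
      ∏ i, overlap (V i) (W i) (x.1 i, x.2 i) (y.1 i, y.2 i) := by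
  simp only [overlap, conjTranspose_productState, productState_mul]
  rw [productState, of_apply, map_prod]

lemma jointExp_productState_rpow (V W : Fin n → Matrix (a × b) (a × b) ℂ)
    {r s : Fin n → a × b → ℝ} (hr : ∀ i p, 0 ≤ r i p) (hs : ∀ i p, 0 ≤ s i p) (t : ℝ) :
    jointExp (productState V) (productState W) (fun x => ∏ i, r i (x.1 i, x.2 i))
        (fun x => ∏ i, s i (x.1 i, x.2 i)) (fun x => x ^ t) =
      ∏ i, jointExp (V i) (W i) (r i) (s i) (fun x => x ^ t) := by
  simp only [jointExp]
  rw [← sum_prod_eq_prod_sum]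
  refine Finset.sum_congr rfl fun x _ => ?_
  rw [← sum_prod_eq_prod_sum]
  refine Finset.sum_congr rfl fun y _ => ?_
  rw [overlap_productState, ← Finset.prod_div_distrib,
    ← Real.finsetProd_rpow _ _ fun i _ => div_nonneg (hr _ _) (hs _ _), ← Finset.prod_mul_distrib,
    ← Finset.prod_mul_distrib]

/-- The product of operators on `B`, regarded as an operator on `Bⁿ`. -/
def productB (σ : Fin n → Matrix b b ℂ) : Matrix (Fin n → b) (Fin n → b) ℂ :=
  of fun x y => ∏ i, σ i (x i) (y i)

lemma trace_productB (σ : Fin n → Matrix b b ℂ) : (productB σ).trace = ∏ i, (σ i).trace := by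
  classical
  simp only [Matrix.trace, diag_apply, productB, of_apply]
  rw [Finset.prod_univ_sum, Fintype.piFinset_univ]

omit [Fintype a] [Fintype b] in
lemma one_kronecker_productB [DecidableEq a] (σ : Fin n → Matrix b b ℂ) :
    (1 : Matrix (Fin n → a) (Fin n → a) ℂ) ⊗ₖ productB σ =
      productState (fun i => (1 : Matrix a a ℂ) ⊗ₖ σ i) := by
  ext x y
  have h1 : (1 : Matrix (Fin n → a) (Fin n → a) ℂ) x.1 y.1 =
      ∏ i, (1 : Matrix a a ℂ) (x.1 i) (y.1 i) := by
    by_cases h : x.1 = y.1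
    · rw [h, one_apply_eq]
      exact (Finset.prod_eq_one fun i _ => one_apply_eq (y.1 i)).symm
    · obtain ⟨i, hi⟩ := Function.ne_iff.1 h
      rw [one_apply_ne h]
      have h0 : (1 : Matrix a a ℂ) (x.1 i) (y.1 i) = 0 := one_apply_ne hi
      exact (Finset.prod_eq_zero (Finset.mem_univ i) h0).symm
  simp only [kroneckerMap_apply, productState, productB, of_apply, Finset.prod_mul_distrib, h1]

end Product

/-! ### From moments to smooth min-entropy -/

section MinEntropy

variable {a b : Type*} [Fintype a] [DecidableEq a] [Fintype b] [DecidableEq b]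

omit [Fintype a] [DecidableEq b] in
lemma neg_logb_le_minEntropy {τ : Matrix (a × b) (a × b) ℂ} {l : ℝ}
    (h : l ∈ minEntropyValues τ) : ((-Real.logb 2 l : ℝ) : EReal) ≤ minEntropy τ := by
  have hnn : ∀ x ∈ minEntropyValues τ, 0 ≤ x := by
    rintro x ⟨σ, hσ, -, rfl⟩
    exact (Complex.le_def.1 hσ.trace_nonneg).1
  have h0 : 0 ≤ sInf (minEntropyValues τ) := Real.sInf_nonneg hnn
  have h1 : sInf (minEntropyValues τ) ≤ l := csInf_le ⟨0, hnn⟩ h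
  rw [minEntropy, EReal.coe_neg, EReal.neg_le_neg_iff, elog2]
  split_ifs with hz
  · exact bot_le
  · exact_mod_cast Real.logb_le_logb_of_le one_lt_two (lt_of_le_of_ne h0 (Ne.symm hz)) h1

/-- If `ε ≥ 1` then every subnormalized operator is in the smoothing ball. -/
lemma smoothMinEntropy_eq_top {ε : ℝ} (hε : 1 ≤ ε) (ρ : Matrix (a × b) (a × b) ℂ) :
    smoothMinEntropy ε ρ = ⊤ := by
  have hball : (0 : Matrix (a × b) (a × b) ℂ) ∈ smoothingBall ε ρ := by
    refine ⟨PosSemidef.zero, ?_, by simp⟩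
    refine le_trans ?_ hε
    rw [cDist, Real.sqrt_le_one]
    linarith [sq_nonneg (fidelity ρ 0)]
  have htop : minEntropy (0 : Matrix (a × b) (a × b) ℂ) = ⊤ := by
    have hz : sInf (minEntropyValues (0 : Matrix (a × b) (a × b) ℂ)) = 0 := by
      refine le_antisymm (csInf_le ⟨0, ?_⟩ ⟨0, PosSemidef.zero, by simpa using PosSemidef.zero,
        by simp⟩) (Real.sInf_nonneg ?_) <;>
      · rintro x ⟨σ, hσ, -, rfl⟩
        exact (Complex.le_def.1 hσ.trace_nonneg).1
    rw [minEntropy, hz, elog2, if_pos rfl, EReal.neg_bot]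
  rw [smoothMinEntropy, eq_top_iff, ← htop]
  exact le_iSup₂_of_le 0 hball le_rfl

/-- Lower bound on the smooth min-entropy of a product state in terms of the moments of the joint
distributions of eigenvalues. -/
theorem neg_logb_le_smoothMinEntropy_productState [Nonempty a] {n : ℕ}
    {V W : Fin n → Matrix (a × b) (a × b) ℂ} (hV : ∀ i, (V i)ᴴ * V i = 1)
    (hW : ∀ i, (W i)ᴴ * W i = 1) {r s : Fin n → a × b → ℝ} (hr : ∀ i p, 0 ≤ r i p)
    (hs : ∀ i p, 0 ≤ s i p) (hr1 : ∀ i, ∑ p, r i p = 1) {σ : Fin n → Matrix b b ℂ}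
    (hσ : ∀ i, (1 : Matrix a a ℂ) ⊗ₖ σ i = conjDiag (W i) (s i)) (hσ1 : ∀ i, (σ i).trace = 1)
    (hsupp : ∀ i p q, s i q = 0 → r i p * overlap (V i) (W i) p q = 0)
    {ε l t : ℝ} (hε0 : 0 ≤ ε) (hl : 0 < l) (ht0 : 0 < t) (ht1 : t ≤ 1)
    (hlt : ∏ i, jointExp (V i) (W i) (r i) (s i) (fun x => x ^ t) ≤ l ^ t * (ε ^ 2 / 2)) :
    ((-Real.logb 2 l : ℝ) : EReal) ≤
      smoothMinEntropy ε (productState (fun i => conjDiag (V i) (r i))) := by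
  set V' := productState V
  set W' := productState W
  set r' : (Fin n → a) × (Fin n → b) → ℝ := fun x => ∏ i, r i (x.1 i, x.2 i) with hr'
  set s' : (Fin n → a) × (Fin n → b) → ℝ := fun x => ∏ i, s i (x.1 i, x.2 i) with hs'
  have hr'0 : ∀ x, 0 ≤ r' x := fun x => Finset.prod_nonneg fun i _ => hr _ _
  have hs'0 : ∀ x, 0 ≤ s' x := fun x => Finset.prod_nonneg fun i _ => hs _ _
  have hr'1 : ∑ x, r' x = 1 := by
    rw [hr', sum_prod_eq_prod_sum]
    simp [hr1]
  have hσ' : (1 : Matrix (Fin n → a) (Fin n → a) ℂ) ⊗ₖ productB σ = conjDiag W' s' := by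
    rw [one_kronecker_productB]
    simp only [hσ, productState_conjDiag]
    rfl
  have hsupp' : ∀ x y, s' y = 0 → r' x * overlap V' W' x y = 0 := by
    intro x y hy
    obtain ⟨i, -, hi⟩ := Finset.prod_eq_zero_iff.1 hy
    rw [overlap_productState, hr', ← Finset.prod_mul_distrib]
    exact Finset.prod_eq_zero (Finset.mem_univ i) (hsupp i _ _ hi)
  obtain ⟨τ, hτ0, hτ1, hτ2, hτ3⟩ := exists_le_conjDiag_fidelity (productState_isometry hV)
    (productState_isometry hW) (s := fun y => l * s' y) hr'0
    (fun y => mul_nonneg hl.le (hs'0 y)) hr'1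
  rw [productState_conjDiag]
  have hfid : 1 - ε ^ 2 / 2 ≤ fidelity (conjDiag V' r') τ := by
    refine le_trans (sub_le_sub_left ?_ 1) hτ3
    have hbound : ∀ x y, r' x * overlap V' W' x y * (r' x / (l * s' y + r' x)) ≤
        (l ^ t)⁻¹ * (r' x * overlap V' W' x y * (r' x / s' y) ^ t) := by
      intro x y
      rcases (hs'0 y).eq_or_lt with h | h
      -- If `s' y = 0` the quotient `r' x / s' y` takes the default value `0`, but the pair has
      -- weight zero.
      · rw [hsupp' x y h.symm]; simp
      · have h1 := div_add_le_rpow_div (hr'0 x) (mul_pos hl h) ht0.le ht1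
        rw [show r' x / (l * s' y) = l⁻¹ * (r' x / s' y) by field_simp,
          Real.mul_rpow (inv_nonneg.2 hl.le) (div_nonneg (hr'0 x) h.le),
          Real.inv_rpow hl.le] at h1
        have h2 := mul_le_mul_of_nonneg_left h1
          (mul_nonneg (hr'0 x) (overlap_nonneg V' W' x y))
        linarith
    calc ∑ x, ∑ y, r' x * overlap V' W' x y * (r' x / (l * s' y + r' x))
        ≤ ∑ x, ∑ y, (l ^ t)⁻¹ * (r' x * overlap V' W' x y * (r' x / s' y) ^ t) :=
          Finset.sum_le_sum fun x _ => Finset.sum_le_sum fun y _ => hbound x y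
      _ = (l ^ t)⁻¹ * jointExp V' W' r' s' (fun x => x ^ t) := by
          simp only [jointExp, Finset.mul_sum]
      _ = (l ^ t)⁻¹ * ∏ i, jointExp (V i) (W i) (r i) (s i) (fun x => x ^ t) := by
          rw [jointExp_productState_rpow V W hr hs]
      _ ≤ (l ^ t)⁻¹ * (l ^ t * (ε ^ 2 / 2)) :=
          mul_le_mul_of_nonneg_left hlt (inv_nonneg.2 (Real.rpow_nonneg hl.le t))
      _ = ε ^ 2 / 2 := by rw [← mul_assoc, inv_mul_cancel₀ (Real.rpow_pos_of_pos hl t).ne', one_mul]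
  have hball : τ ∈ smoothingBall ε (conjDiag V' r') := by
    refine ⟨hτ0, ?_, hτ2⟩
    rw [cDist, Real.sqrt_le_left hε0]
    -- `1 - F² ≤ 2(1 - F) ≤ ε²`.
    nlinarith [sq_nonneg (fidelity (conjDiag V' r') τ - 1)]
  refine le_iSup₂_of_le τ hball (neg_logb_le_minEntropy ⟨(l : ℂ) • productB σ, ?_, ?_, ?_⟩)
  · refine PosSemidef.smul ?_ (by exact_mod_cast hl.le)
    have hps := posSemidef_conjDiag W' hs'0
    rw [← hσ'] at hps
    -- Positivity of the operator on `Bⁿ` is read off from a diagonal block of `id ⊗ σ`, which needs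
    -- a basis vector of `A`.
    obtain ⟨a0⟩ := ‹Nonempty a›
    have := hps.submatrix (fun y : Fin n → b => ((fun _ : Fin n => a0), y))
    convert this using 1
    ext x y
    simp
  · have : (1 : Matrix (Fin n → a) (Fin n → a) ℂ) ⊗ₖ ((l : ℂ) • productB σ) =
        conjDiag W' (fun y => l * s' y) := by
      rw [kronecker_smul, hσ']
      ext x y
      simp only [Matrix.smul_apply, conjDiag_apply, smul_eq_mul, Finset.mul_sum]
      refine Finset.sum_congr rfl fun k _ => ?_
      push_cast
      ring
    rw [this]
    exact hτ1
  · rw [trace_smul, trace_productB]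
    simp [hσ1]

end MinEntropy

/-! ### Scalar inequalities and the moment bound -/

section Scalar

/-- Equivalent to `(1 + b)/(1 - b) ≤ exp (2u)`. Here `2u ≥ 2.196 b` because `log 3 > 1.098`, and the
cubic Taylor polynomial of the exponential suffices for `b ≤ 2/5`. -/
lemma mul_cosh_le_sinh {b u : ℝ} (hb0 : 0 ≤ b) (hb : b ≤ 2 / 5) (hu : Real.log 3 * b ≤ u) :
    b * Real.cosh u ≤ Real.sinh u := by
  have h3 := Real.log_three_gt_d9
  have hx : 0 ≤ 2 * u := by nlinarith
  have hub : 1.098 * b ≤ u := le_trans (by nlinarith) hu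
  have h1 : 1 + b ≤ (1 - b) * Real.exp (2 * u) := by
    have h2 : 1 + 2.196 * b + (2.196 * b) ^ 2 / 2 + (2.196 * b) ^ 3 / 6 ≤ Real.exp (2 * u) := by
      have h4 := Real.sum_le_exp_of_nonneg (x := 2.196 * b) (by positivity) 4
      simp only [Finset.sum_range_succ, Finset.sum_range_zero, Nat.factorial] at h4
      norm_num at h4
      have h5 : Real.exp (2.196 * b) ≤ Real.exp (2 * u) := Real.exp_le_exp.2 (by linarith)
      norm_num1 at h5 ⊢
      linarith
    have h6 : 1 + b ≤ (1 - b) * (1 + 2.196 * b + (2.196 * b) ^ 2 / 2 + (2.196 * b) ^ 3 / 6) := by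
      have : (1 - b) * (1 + 2.196 * b + (2.196 * b) ^ 2 / 2 + (2.196 * b) ^ 3 / 6) - (1 + b) =
        b * (0.196 + 0.215208 * b - 20193867 / 31250000 * b ^ 2 - 55156383 / 31250000 * b ^ 3) := by ring_nf
      have h7 : 0 ≤ 0.196 + 0.215208 * b - 20193867 / 31250000 * b ^ 2 - 55156383 / 31250000 * b ^ 3 := by
        have h8 : b ^ 2 ≤ 2 / 5 * b := by nlinarith
        have h9 : b ^ 3 ≤ 4 / 25 * b := by nlinarith
        nlinarith
      nlinarith [mul_nonneg hb0 h7]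
    exact h6.trans (mul_le_mul_of_nonneg_left h2 (by linarith))
  have h10 : Real.exp (2 * u) = Real.exp u * Real.exp u := by rw [two_mul, Real.exp_add]
  have h11 : Real.exp u * Real.exp (-u) = 1 := by rw [← Real.exp_add]; simp
  have h12 := Real.exp_pos (-u)
  have h13 : (1 + b) * Real.exp (-u) ≤ (1 - b) * Real.exp u := by
    calc (1 + b) * Real.exp (-u) ≤ (1 - b) * Real.exp (2 * u) * Real.exp (-u) :=
          mul_le_mul_of_nonneg_right h1 h12.le
      _ = _ := by rw [h10]; linear_combination (1 - b) * Real.exp u * h11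
  rw [Real.cosh_eq, Real.sinh_eq]
  linarith

/-- With `u = b log y`, the second derivative is `b y⁻² (b cosh u - sinh u)`, and `y ≥ 3` gives `u ≥
b log 3`. The summand `1` in `√x + 1/√x + 1` puts that quantity in the range `[3, ∞)`. -/
lemma concaveOn_cosh_mul_log {b : ℝ} (hb0 : 0 ≤ b) (hb : b ≤ 2 / 5) :
    ConcaveOn ℝ (Set.Ici 3) (fun y => Real.cosh (b * Real.log y)) := by
  have hd : ∀ y : ℝ, 0 < y → HasDerivAt (fun y => Real.cosh (b * Real.log y))
      (Real.sinh (b * Real.log y) * (b * y⁻¹)) y := fun y hy =>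
    ((Real.hasDerivAt_log hy.ne').const_mul b).cosh
  have hd2 : ∀ y : ℝ, 0 < y → HasDerivAt (fun y => Real.sinh (b * Real.log y) * (b * y⁻¹))
      (Real.cosh (b * Real.log y) * (b * y⁻¹) * (b * y⁻¹) +
        Real.sinh (b * Real.log y) * (b * (-(y ^ 2)⁻¹))) y := fun y hy =>
    ((Real.hasDerivAt_log hy.ne').const_mul b).sinh.mul ((hasDerivAt_inv hy.ne').const_mul b)
  have hpos : ∀ y ∈ Set.Ici (3 : ℝ), 0 < y := fun y hy => lt_of_lt_of_le three_pos hy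
  refine concaveOn_of_hasDerivWithinAt2_nonpos (convex_Ici 3)
    (f' := fun y => Real.sinh (b * Real.log y) * (b * y⁻¹))
    (f'' := fun y => Real.cosh (b * Real.log y) * (b * y⁻¹) * (b * y⁻¹) +
        Real.sinh (b * Real.log y) * (b * (-(y ^ 2)⁻¹)))
    (fun y hy => (hd y (hpos y hy)).continuousAt.continuousWithinAt)
    (fun y hy => (hd y (hpos y (interior_subset hy))).hasDerivWithinAt)
    (fun y hy => (hd2 y (hpos y (interior_subset hy))).hasDerivWithinAt) fun y hy => ?_
  have hy3 : (3 : ℝ) ≤ y := interior_subset hy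
  have h := mul_cosh_le_sinh (u := b * Real.log y) hb0 hb (by
    rw [mul_comm]
    exact mul_le_mul_of_nonneg_left (Real.log_le_log three_pos hy3) hb0)
  have e : Real.cosh (b * Real.log y) * (b * y⁻¹) * (b * y⁻¹) +
        Real.sinh (b * Real.log y) * (b * (-(y ^ 2)⁻¹)) =
      b * (y ^ 2)⁻¹ * (b * Real.cosh (b * Real.log y) - Real.sinh (b * Real.log y)) := by
    ring
  rw [e]
  exact mul_nonpos_of_nonneg_of_nonpos (by positivity) (by linarith)

lemma three_le_sqrt_add_inv {x : ℝ} (hx : 0 < x) :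
    3 ≤ Real.sqrt x + (Real.sqrt x)⁻¹ + 1 := by
  have h := Real.sqrt_pos.2 hx
  have : (Real.sqrt x - 1) ^ 2 / Real.sqrt x = Real.sqrt x + (Real.sqrt x)⁻¹ - 2 := by
    field_simp; ring
  have h0 : 0 ≤ (Real.sqrt x - 1) ^ 2 / Real.sqrt x := by positivity
  linarith

lemma abs_log_le_two_mul_log {x : ℝ} (hx : 0 < x) :
    |Real.log x| ≤ 2 * Real.log (Real.sqrt x + (Real.sqrt x)⁻¹ + 1) := by
  have h := Real.sqrt_pos.2 hx
  have h' := inv_pos.2 h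
  have e : Real.log x = 2 * Real.log (Real.sqrt x) := by rw [Real.log_sqrt hx.le]; ring
  rw [e, abs_mul, abs_two]
  refine mul_le_mul_of_nonneg_left (abs_le.2 ⟨?_, ?_⟩) zero_le_two
  · rw [neg_le, ← Real.log_inv]
    exact Real.log_le_log h' (by linarith)
  · exact Real.log_le_log h (by linarith)

/-- With `z = t log x`, write `exp z = 2 cosh z - exp (-z)` and use `exp (-z) ≥ 1 - z`. The even
remainder `cosh z` then depends only on `|log x|`, which is at most `2 log y` for `y = √x + 1/√x +
1`. -/
lemma rpow_le_one_add_log_add_cosh {x t : ℝ} (hx : 0 < x) (ht : 0 ≤ t) :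
    x ^ t ≤ 1 + t * Real.log x +
      2 * (Real.cosh (2 * t * Real.log (Real.sqrt x + (Real.sqrt x)⁻¹ + 1)) - 1) := by
  have h1 : Real.cosh (t * Real.log x) ≤
      Real.cosh (2 * t * Real.log (Real.sqrt x + (Real.sqrt x)⁻¹ + 1)) := by
    rw [Real.cosh_le_cosh, abs_mul, abs_of_nonneg ht]
    refine le_trans ?_ (le_abs_self _)
    nlinarith [mul_le_mul_of_nonneg_left (abs_log_le_two_mul_log hx) ht]
  have h2 := Real.add_one_le_exp (-(t * Real.log x))
  rw [Real.cosh_eq] at h1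
  rw [Real.rpow_def_of_pos hx, mul_comm (Real.log x)]
  linarith

/-- Second order bound on the moments of a positive random variable `x`, in terms of the
expectation of `√x + 1/√x + 1`. -/
lemma sum_mul_rpow_le_exp {ι : Type*} [Fintype ι] {P x : ι → ℝ} (hP : ∀ i, 0 ≤ P i)
    (hP1 : ∑ i, P i = 1) (hx : ∀ i, P i ≠ 0 → 0 < x i) {γ t : ℝ}
    (hγ : ∑ i, P i * (Real.sqrt (x i) + (Real.sqrt (x i))⁻¹ + 1) ≤ γ)
    (ht0 : 0 ≤ t) (ht : t ≤ 1 / 5) (htγ : (2 * t * Real.log γ) ^ 2 ≤ 1 / 5) :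
    ∑ i, P i * x i ^ t ≤
      Real.exp (t * ∑ i, P i * Real.log (x i) + 11 / 10 * (2 * t * Real.log γ) ^ 2) := by
  -- The maximum with `3` changes nothing where `P i ≠ 0`; it keeps the remaining points in the
  -- domain of concavity.
  set y : ι → ℝ := fun i => max 3 (Real.sqrt (x i) + (Real.sqrt (x i))⁻¹ + 1) with hy
  have hPy : ∀ i, P i ≠ 0 → y i = Real.sqrt (x i) + (Real.sqrt (x i))⁻¹ + 1 := fun i hi =>
    max_eq_right (three_le_sqrt_add_inv (hx i hi))
  have hG : ∑ i, P i * y i ≤ γ := by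
    refine le_trans (le_of_eq (Finset.sum_congr rfl fun i _ => ?_)) hγ
    by_cases hi : P i = 0
    · simp [hi]
    · rw [hPy i hi]
  have hG3 : 3 ≤ ∑ i, P i * y i := by
    calc (3 : ℝ) = ∑ i, P i * 3 := by rw [← Finset.sum_mul, hP1, one_mul]
      _ ≤ _ := Finset.sum_le_sum fun i _ => mul_le_mul_of_nonneg_left (le_max_left _ _) (hP i)
  have hJ : ∑ i, P i * Real.cosh (2 * t * Real.log (y i)) ≤
      Real.cosh (2 * t * Real.log (∑ i, P i * y i)) := by
    have := (concaveOn_cosh_mul_log (b := 2 * t) (by linarith) (by linarith)).le_map_sum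
      (t := Finset.univ) (w := P) (p := y) (fun i _ => hP i) hP1 (fun i _ => Set.mem_Ici.2 (le_max_left _ _))
    simpa only [smul_eq_mul] using this
  have hmono : Real.cosh (2 * t * Real.log (∑ i, P i * y i)) ≤ Real.cosh (2 * t * Real.log γ) := by
    have h0 : 0 ≤ Real.log (∑ i, P i * y i) := Real.log_nonneg (by linarith)
    have h1 : Real.log (∑ i, P i * y i) ≤ Real.log γ := Real.log_le_log (by linarith) hG
    rw [Real.cosh_le_cosh, abs_of_nonneg (by positivity)]
    exact le_trans (mul_le_mul_of_nonneg_left h1 (by positivity)) (le_abs_self _)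
  -- With `z = u²/2 ≤ 1/10`, `cosh u ≤ exp z ≤ 1 + z + z²`, so the left side is at most `u² (1 +
  -- u²/2) ≤ 11/10 u²`.
  have hcosh : 2 * (Real.cosh (2 * t * Real.log γ) - 1) ≤ 11 / 10 * (2 * t * Real.log γ) ^ 2 := by
    set u := 2 * t * Real.log γ
    have h1 := Real.cosh_le_exp_half_sq u
    have h2 := (abs_le.1 (Real.abs_exp_sub_one_sub_id_le (x := u ^ 2 / 2) (by
      rw [abs_of_nonneg (by positivity)]; linarith))).2
    nlinarith [sq_nonneg u]
  have hterm : ∀ i, P i * x i ^ t ≤ P i + t * (P i * Real.log (x i)) +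
      2 * (P i * Real.cosh (2 * t * Real.log (y i)) - P i) := by
    intro i
    by_cases hi : P i = 0
    · simp [hi]
    · rw [hPy i hi]
      have := mul_le_mul_of_nonneg_left (rpow_le_one_add_log_add_cosh (hx i hi) ht0) (hP i)
      linarith
  have hsum := Finset.sum_le_sum fun i (_ : i ∈ Finset.univ) => hterm i
  rw [Finset.sum_add_distrib, Finset.sum_add_distrib, ← Finset.mul_sum, ← Finset.mul_sum,
    Finset.sum_sub_distrib, hP1] at hsum
  refine le_trans ?_ (Real.add_one_le_exp _)
  linarith

end Scalar

/-! ### Partial traces and spectral data of a bipartite state -/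

section PartialTrace

variable {a b : Type*} [Fintype a] [Fintype b]

/-- Each `A`-block of the conjugated operator is a combination of blocks `E * _ * Eᴴ`, whose traces
do not see the isometry `E`. -/
lemma reduceB_kronecker_conj [DecidableEq a] {E : Matrix a a ℂ} (hE : Eᴴ * E = 1)
    (F : Matrix b b ℂ) (X : Matrix (a × b) (a × b) ℂ) :
    reduceB ((E ⊗ₖ F) * X * (E ⊗ₖ F)ᴴ) = F * reduceB X * Fᴴ := by
  have hblock : ∀ i j, ((E ⊗ₖ F) * X * (E ⊗ₖ F)ᴴ).submatrix (fun k => (k, i)) (fun k => (k, j)) =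
      ∑ q', ∑ q, (F i q * star (F j q')) •
        (E * X.submatrix (fun k => (k, q)) (fun k => (k, q')) * Eᴴ) := by
    intro i j
    ext k l
    simp only [submatrix_apply, Matrix.mul_apply, conjTranspose_apply, kroneckerMap_apply,
      Fintype.sum_prod_type, Matrix.sum_apply, Matrix.smul_apply, smul_eq_mul, star_mul',
      Finset.sum_mul, Finset.mul_sum]
    rw [Finset.sum_comm]
    refine Finset.sum_congr rfl fun q' _ => ?_
    rw [Finset.sum_comm' (t' := Finset.univ) (s' := fun _ => Finset.univ) (by simp)]
    conv_rhs => rw [Finset.sum_comm]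
    rw [Finset.sum_comm]
    refine Finset.sum_congr rfl fun p' _ => ?_
    rw [Finset.sum_comm]
    refine Finset.sum_congr rfl fun q _ => Finset.sum_congr rfl fun p _ => ?_
    ring
  ext i j
  have htr : ∀ (Y : Matrix (a × b) (a × b) ℂ) i j,
      reduceB Y i j = (Y.submatrix (fun k => (k, i)) (fun k => (k, j))).trace := fun Y i j => rfl
  rw [htr, hblock, trace_sum]
  simp only [trace_sum, trace_smul, Matrix.mul_apply, Finset.sum_mul, smul_eq_mul,
    conjTranspose_apply]
  refine Finset.sum_congr rfl fun q' _ => Finset.sum_congr rfl fun q _ => ?_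
  rw [trace_mul_comm, ← Matrix.mul_assoc, hE, Matrix.one_mul, ← htr]
  ring

lemma reduceA_kronecker_conj [DecidableEq b] (E : Matrix a a ℂ) {F : Matrix b b ℂ}
    (hF : Fᴴ * F = 1) (X : Matrix (a × b) (a × b) ℂ) :
    reduceA ((E ⊗ₖ F) * X * (E ⊗ₖ F)ᴴ) = E * reduceA X * Eᴴ := by
  have h := reduceB_kronecker_conj hF E (X.submatrix Prod.swap Prod.swap)
  have hEF : F ⊗ₖ E = (E ⊗ₖ F).submatrix (Equiv.prodComm b a) (Equiv.prodComm b a) := by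
    ext x y
    simp [mul_comm]
  have hX : X.submatrix Prod.swap Prod.swap =
      X.submatrix (Equiv.prodComm b a) (Equiv.prodComm b a) := rfl
  rw [hEF, hX, conjTranspose_submatrix, submatrix_mul_equiv, submatrix_mul_equiv] at h
  exact h

omit [Fintype b] in
lemma posSemidef_reduceB {ρ : Matrix (a × b) (a × b) ℂ} (hρ : ρ.PosSemidef) :
    (reduceB ρ).PosSemidef := by
  have : reduceB ρ = ∑ k, ρ.submatrix (fun i : b => (k, i)) (fun i => (k, i)) := by
    ext i j
    simp [reduceB, Matrix.sum_apply]
  rw [this]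
  exact posSemidef_sum _ fun k _ => hρ.submatrix _

omit [Fintype a] in
lemma posSemidef_reduceA {ρ : Matrix (a × b) (a × b) ℂ} (hρ : ρ.PosSemidef) :
    (reduceA ρ).PosSemidef := by
  have : reduceA ρ = ∑ k, ρ.submatrix (fun i : a => (i, k)) (fun i => (i, k)) := by
    ext i j
    simp [reduceA, Matrix.sum_apply]
  rw [this]
  exact posSemidef_sum _ fun k _ => hρ.submatrix _

lemma trace_reduceB (ρ : Matrix (a × b) (a × b) ℂ) :
    (reduceB ρ).trace = ρ.trace := by
  simp only [Matrix.trace, diag_apply, reduceB, of_apply, Fintype.sum_prod_type]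
  exact Finset.sum_comm

end PartialTrace

/-- Spectral decompositions of a density operator and of its reduced operators. -/
structure SpectralData {a b : Type*} [Fintype a] [DecidableEq a] [Fintype b] [DecidableEq b]
    (ρ : Matrix (a × b) (a × b) ℂ) where
  V : Matrix (a × b) (a × b) ℂ
  r : a × b → ℝ
  E : Matrix a a ℂ
  α : a → ℝ
  F : Matrix b b ℂ
  β : b → ℝ
  isometry_V : Vᴴ * V = 1
  isometry_E : Eᴴ * E = 1
  isometry_F : Fᴴ * F = 1
  r_nonneg : ∀ i, 0 ≤ r i
  β_nonneg : ∀ j, 0 ≤ β j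
  sum_r : ∑ i, r i = 1
  sum_β : ∑ j, β j = 1
  eq_conjDiag : ρ = conjDiag V r
  reduceA_eq : reduceA ρ = conjDiag E α
  reduceB_eq : reduceB ρ = conjDiag F β
  rank_eq : (reduceA ρ).rank = Fintype.card {k // α k ≠ 0}

section SpectralData

variable {a b : Type*} [Fintype a] [DecidableEq a] [Fintype b] [DecidableEq b]

lemma sum_eigenvalues_eq_one {m : Type*} [Fintype m] [DecidableEq m] {A : Matrix m m ℂ}
    (hA : A.IsHermitian) (h1 : A.trace = 1) : ∑ i, hA.eigenvalues i = 1 := by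
  rw [hA.trace_eq_sum_eigenvalues] at h1
  apply Complex.ofReal_injective
  push_cast
  exact h1

/-- A density operator has spectral data. -/
noncomputable def IsDensity.spectralData {ρ : Matrix (a × b) (a × b) ℂ} (hρ : IsDensity ρ) :
    SpectralData ρ :=
  have hB := posSemidef_reduceB hρ.1
  have hA := posSemidef_reduceA hρ.1
  { V := hρ.1.isHermitian.eigenvectorUnitary
    r := hρ.1.isHermitian.eigenvalues
    E := hA.isHermitian.eigenvectorUnitary
    α := hA.isHermitian.eigenvalues
    F := hB.isHermitian.eigenvectorUnitary
    β := hB.isHermitian.eigenvalues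
    isometry_V := (exists_eq_conjDiag _).1
    isometry_E := (exists_eq_conjDiag _).1
    isometry_F := (exists_eq_conjDiag _).1
    r_nonneg := hρ.1.eigenvalues_nonneg
    β_nonneg := hB.eigenvalues_nonneg
    sum_r := sum_eigenvalues_eq_one _ hρ.2
    sum_β := sum_eigenvalues_eq_one _ ((trace_reduceB ρ).trans hρ.2)
    eq_conjDiag := (exists_eq_conjDiag _).2
    reduceA_eq := (exists_eq_conjDiag _).2
    reduceB_eq := (exists_eq_conjDiag _).2
    rank_eq := hA.isHermitian.rank_eq_card_non_zero_eigs }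

lemma conjDiag_kronecker_conjDiag {m k : Type*} [Fintype m] [DecidableEq m] [Fintype k]
    [DecidableEq k] (A : Matrix m m ℂ) (B : Matrix k k ℂ) (d : m → ℝ) (e : k → ℝ) :
    conjDiag A d ⊗ₖ conjDiag B e = conjDiag (A ⊗ₖ B) (fun x => d x.1 * e x.2) := by
  rw [conjDiag, conjDiag, conjDiag, mul_kronecker_mul, mul_kronecker_mul,
    diagonal_kronecker_diagonal, conjTranspose_kronecker]
  simp

lemma conjTranspose_kronecker_mul_self {m k : Type*} [Fintype m] [DecidableEq m] [Fintype k]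
    [DecidableEq k] {A : Matrix m m ℂ} {B : Matrix k k ℂ} (hA : Aᴴ * A = 1) (hB : Bᴴ * B = 1) :
    (A ⊗ₖ B)ᴴ * (A ⊗ₖ B) = 1 := by
  rw [conjTranspose_kronecker, ← mul_kronecker_mul, hA, hB, one_kronecker_one]

namespace SpectralData

variable {ρ : Matrix (a × b) (a × b) ℂ} (D : SpectralData ρ)

/-- The product basis of eigenvectors of the reduced operators. -/
def W : Matrix (a × b) (a × b) ℂ := D.E ⊗ₖ D.F

/-- The eigenvalues of `id_A ⊗ ρ_B`. -/
def s (q : a × b) : ℝ := D.β q.2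

lemma s_nonneg (q : a × b) : 0 ≤ D.s q := D.β_nonneg q.2

lemma isometry_W : D.Wᴴ * D.W = 1 :=
  conjTranspose_kronecker_mul_self D.isometry_E D.isometry_F

lemma one_kronecker_conjDiag_F (f : b → ℝ) :
    (1 : Matrix a a ℂ) ⊗ₖ conjDiag D.F f = conjDiag D.W (fun q => f q.2) := by
  have h1 : (1 : Matrix a a ℂ) = conjDiag D.E (fun _ => 1) := by
    have : D.E * D.Eᴴ = 1 := mul_eq_one_comm.1 D.isometry_E
    simp [conjDiag, this]
  rw [h1, conjDiag_kronecker_conjDiag]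
  simp [W]

lemma one_kronecker_reduceB : (1 : Matrix a a ℂ) ⊗ₖ reduceB ρ = conjDiag D.W D.s := by
  rw [D.reduceB_eq, one_kronecker_conjDiag_F]
  rfl

lemma conj_W_eq : D.Wᴴ * ρ * D.W = conjDiag (D.Wᴴ * D.V) D.r := by
  refine (congrArg (fun X => D.Wᴴ * X * D.W) D.eq_conjDiag).trans ?_
  simp only [conjDiag, conjTranspose_mul, conjTranspose_conjTranspose, Matrix.mul_assoc]

/-- In the product eigenbasis `W` the reduced operators become diagonal, so the marginals of the
joint law can be read from diagonal entries of `ρ`. -/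
lemma reduceB_conjDiag : reduceB (conjDiag (D.Wᴴ * D.V) D.r) =
    diagonal (fun j => (D.β j : ℂ)) := by
  have h := reduceB_kronecker_conj (E := D.Eᴴ) (by
    rw [conjTranspose_conjTranspose]; exact mul_eq_one_comm.1 D.isometry_E) D.Fᴴ ρ
  rw [← conjTranspose_kronecker, conjTranspose_conjTranspose, conjTranspose_conjTranspose,
    D.reduceB_eq, conjTranspose_mul_conjDiag_mul D.isometry_F] at h
  rw [← conj_W_eq]
  exact h

lemma reduceA_conjDiag : reduceA (conjDiag (D.Wᴴ * D.V) D.r) =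
    diagonal (fun j => (D.α j : ℂ)) := by
  have h := reduceA_kronecker_conj D.Eᴴ (F := D.Fᴴ) (by
    rw [conjTranspose_conjTranspose]; exact mul_eq_one_comm.1 D.isometry_F) ρ
  rw [← conjTranspose_kronecker, conjTranspose_conjTranspose, conjTranspose_conjTranspose,
    D.reduceA_eq, conjTranspose_mul_conjDiag_mul D.isometry_E] at h
  rw [← conj_W_eq]
  exact h

lemma conjDiag_diag (q : a × b) : conjDiag (D.Wᴴ * D.V) D.r q q =
    ((∑ i, D.r i * overlap D.V D.W i q : ℝ) : ℂ) := by
  rw [conjDiag_apply]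
  push_cast
  refine Finset.sum_congr rfl fun i _ => ?_
  rw [overlap, Complex.normSq_eq_conj_mul_self, Complex.star_def]
  ring

/-- The weights of the joint distribution over `e_k ⊗ f_j`, summed over `k`, give the spectrum of
`ρ_B`. -/
lemma sum_weight_B (j : b) : ∑ k, ∑ i, D.r i * overlap D.V D.W i (k, j) = D.β j := by
  have h := congrFun (congrFun D.reduceB_conjDiag j) j
  rw [reduceB, of_apply, diagonal_apply_eq] at h
  simp only [conjDiag_diag] at h
  exact_mod_cast h

lemma sum_weight_A (k : a) : ∑ j, ∑ i, D.r i * overlap D.V D.W i (k, j) = D.α k := by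
  have h := congrFun (congrFun D.reduceA_conjDiag k) k
  rw [reduceA, of_apply, diagonal_apply_eq] at h
  simp only [conjDiag_diag] at h
  exact_mod_cast h

lemma weight_nonneg (i q : a × b) : 0 ≤ D.r i * overlap D.V D.W i q :=
  mul_nonneg (D.r_nonneg i) (overlap_nonneg _ _ _ _)

/-- The weights are nonnegative and those over a given `j` add up to `β j`. In effect `ρ` is
supported in the support of `id_A ⊗ ρ_B`, so the convention for division by zero is harmless. -/
lemma weight_eq_zero_of_s (i q : a × b) (h : D.s q = 0) : D.r i * overlap D.V D.W i q = 0 := by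
  have h1 := D.sum_weight_B q.2
  rw [show D.β q.2 = 0 from h] at h1
  have h2 := (Finset.sum_eq_zero_iff_of_nonneg
    fun k _ => Finset.sum_nonneg fun i _ => D.weight_nonneg i (k, q.2)).1 h1 q.1 (Finset.mem_univ _)
  exact (Finset.sum_eq_zero_iff_of_nonneg fun i _ => D.weight_nonneg i q).1 h2 i (Finset.mem_univ _)

lemma weight_eq_zero_of_α (i q : a × b) (h : D.α q.1 = 0) :
    D.r i * overlap D.V D.W i q = 0 := by
  have h1 := D.sum_weight_A q.1
  rw [h] at h1
  have h2 := (Finset.sum_eq_zero_iff_of_nonneg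
    fun j _ => Finset.sum_nonneg fun i _ => D.weight_nonneg i (q.1, j)).1 h1 q.2 (Finset.mem_univ _)
  exact (Finset.sum_eq_zero_iff_of_nonneg fun i _ => D.weight_nonneg i q).1 h2 i (Finset.mem_univ _)

lemma sum_weight : ∑ i, ∑ q, D.r i * overlap D.V D.W i q = 1 := by
  simp only [← Finset.mul_sum, sum_overlap D.isometry_V D.isometry_W, mul_one, D.sum_r]

end SpectralData

end SpectralData

/-! ### Entropic quantities as expectations of the joint law -/

section JointExp

variable {m : Type*} [Fintype m]

/-- Cauchy–Schwarz for a law of total mass one. -/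
lemma jointExp_le_sqrt {V W : Matrix m m ℂ} {r : m → ℝ} (s : m → ℝ) (hr : ∀ i, 0 ≤ r i)
    (h1 : ∑ i, ∑ j, r i * overlap V W i j = 1) (f : ℝ → ℝ) :
    jointExp V W r s f ≤ Real.sqrt (jointExp V W r s (fun x => f x ^ 2)) := by
  apply Real.le_sqrt_of_sq_le
  simp only [jointExp, ← Fintype.sum_prod_type'] at h1 ⊢
  have := Finset.sum_sq_le_sum_mul_sum_of_sq_le_mul Finset.univ
    (r := fun x : m × m => r x.1 * overlap V W x.1 x.2 * f (r x.1 / s x.2))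
    (f := fun x => r x.1 * overlap V W x.1 x.2)
    (g := fun x => r x.1 * overlap V W x.1 x.2 * f (r x.1 / s x.2) ^ 2)
    (fun x _ => mul_nonneg (hr _) (overlap_nonneg _ _ _ _))
    (fun x _ => mul_nonneg (mul_nonneg (hr _) (overlap_nonneg _ _ _ _)) (sq_nonneg _))
    (fun x _ => le_of_eq (by ring))
  rwa [h1, one_mul] at this

lemma jointExp_add (V W : Matrix m m ℂ) (r s : m → ℝ) (f g : ℝ → ℝ) :
    jointExp V W r s (fun x => f x + g x) = jointExp V W r s f + jointExp V W r s g := by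
  simp only [jointExp, mul_add, Finset.sum_add_distrib]

lemma star_dotProduct_conjDiag_mulVec [DecidableEq m] (Y : Matrix m m ℂ) (d : m → ℝ)
    (φ : m → ℂ) :
    star φ ⬝ᵥ (conjDiag Y d *ᵥ φ) = ((∑ k, d k * Complex.normSq ((Yᴴ *ᵥ φ) k) : ℝ) : ℂ) := by
  have h1 : star φ ᵥ* Y = star (Yᴴ *ᵥ φ) := by rw [star_mulVec, conjTranspose_conjTranspose]
  rw [conjDiag, ← mulVec_mulVec, ← mulVec_mulVec, dotProduct_mulVec, h1, dotProduct]
  push_cast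
  refine Finset.sum_congr rfl fun k _ => ?_
  rw [mulVec_diagonal, Complex.normSq_eq_conj_mul_self, Pi.star_apply, Complex.star_def]
  ring

lemma conjDiag_transpose [DecidableEq m] (W : Matrix m m ℂ) (d : m → ℝ) :
    (conjDiag W d)ᵀ = conjDiag Wᴴᵀ d := by
  ext i j
  rw [transpose_apply, conjDiag_apply, conjDiag_apply]
  refine Finset.sum_congr rfl fun k _ => ?_
  simp only [transpose_apply, conjTranspose_apply, star_star]
  ring

end JointExp

namespace SpectralData

variable {a b : Type*} [Fintype a] [DecidableEq a] [Fintype b] [DecidableEq b]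
  {ρ : Matrix (a × b) (a × b) ℂ} (D : SpectralData ρ)

/-- The expectation for the joint distribution of the eigenvalues of `ρ` and of `id_A ⊗ ρ_B`. -/
noncomputable def expect (f : ℝ → ℝ) : ℝ := jointExp D.V D.W D.r D.s f

lemma relOp_eq : relOp ρ =
    conjDiag (D.V ⊗ₖ D.Wᴴᵀ) (fun x => D.r x.1 * (D.s x.2)⁻¹) := by
  have h1 : (1 : Matrix a a ℂ) ⊗ₖ cfc (fun t : ℝ => t⁻¹) (reduceB ρ) =
      conjDiag D.W (fun q => (D.s q)⁻¹) := by
    rw [D.reduceB_eq, cfc_conjDiag D.isometry_F, one_kronecker_conjDiag_F]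
    rfl
  rw [relOp, h1, conjDiag_transpose,
    ← conjDiag_kronecker_conjDiag D.V D.Wᴴᵀ D.r (fun q => (D.s q)⁻¹)]
  exact congrArg (fun X => X ⊗ₖ conjDiag D.Wᴴᵀ fun q => (D.s q)⁻¹) D.eq_conjDiag

omit D in
lemma purification_apply (x : (a × b) × (a × b)) :
    purification ρ x = msqrt ρ x.1 x.2 := by
  rw [purification, mulVec, dotProduct, Fintype.sum_prod_type]
  simp [one_apply]

/-- `X` is diagonal in the basis `v_i ⊗ conj w_q` with eigenvalues `r_i / s_q`, and the coordinates
of `φ` there are `√r_i ⟨v_i|w_q⟩`, whose squared moduli are the joint weights. -/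
lemma entropyContribution_eq : entropyContribution ρ =
    D.expect (fun t => Real.sqrt t + (Real.sqrt t)⁻¹ + 1) := by
  have hW : (D.Wᴴᵀ)ᴴ * D.Wᴴᵀ = 1 := by
    have h := congrArg transpose D.isometry_W
    rw [transpose_mul, transpose_one] at h
    calc (D.Wᴴᵀ)ᴴ * D.Wᴴᵀ = D.Wᵀ * D.Wᴴᵀ := by
          congr 1
          ext i j
          simp
      _ = 1 := h
  rw [entropyContribution, D.relOp_eq,
    cfc_conjDiag (conjTranspose_kronecker_mul_self D.isometry_V hW),
    star_dotProduct_conjDiag_mulVec, Complex.ofReal_re, expect, jointExp, Fintype.sum_prod_type]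
  refine Finset.sum_congr rfl fun i _ => Finset.sum_congr rfl fun q _ => ?_
  have hvec : ((D.V ⊗ₖ D.Wᴴᵀ)ᴴ *ᵥ purification ρ) (i, q) =
      (D.Vᴴ * msqrt ρ * D.W) i q := by
    rw [mulVec, dotProduct, Fintype.sum_prod_type, Finset.sum_comm]
    simp only [Matrix.mul_apply, Finset.sum_mul]
    refine Finset.sum_congr rfl fun y _ => Finset.sum_congr rfl fun x _ => ?_
    simp only [conjTranspose_apply, kroneckerMap_apply, transpose_apply, purification_apply,
      star_mul', star_star]
    ring
  have hsq : (D.Vᴴ * msqrt ρ * D.W) i q =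
      ((Real.sqrt (D.r i) : ℝ) : ℂ) * (D.Vᴴ * D.W) i q := by
    have h1 : msqrt ρ = conjDiag D.V (fun i => Real.sqrt (D.r i)) :=
      (congrArg msqrt D.eq_conjDiag).trans (msqrt_conjDiag D.isometry_V _)
    rw [h1]
    calc (D.Vᴴ * conjDiag D.V (fun i => Real.sqrt (D.r i)) * D.W) i q
        = ((D.Vᴴ * D.V) * diagonal (fun i => ((Real.sqrt (D.r i) : ℝ) : ℂ)) *
            (D.Vᴴ * D.W)) i q := by simp only [conjDiag, Matrix.mul_assoc]
      _ = _ := by rw [D.isometry_V, Matrix.one_mul, diagonal_mul]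
  rw [hvec, hsq, Complex.normSq_mul, Complex.normSq_ofReal, Real.mul_self_sqrt (D.r_nonneg i),
    overlap_comm, overlap, div_eq_mul_inv]
  ring

lemma entropy_conjDiag {m : Type*} [Fintype m] [DecidableEq m] {V : Matrix m m ℂ}
    (hV : Vᴴ * V = 1) (d : m → ℝ) :
    entropy (conjDiag V d) = -∑ i, d i * Real.logb 2 (d i) := by
  rw [entropy, cfc_conjDiag hV, conjDiag_mul_conjDiag hV, trace_conjDiag hV, ← Complex.ofReal_sum,
    Complex.ofReal_re]

/-- Split the logarithm of the quotient: the first marginal of the joint law is `r`, and the second,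
summed over the `A`-index, is `β`. -/
lemma condEntropy_eq : condEntropy ρ = -D.expect (Real.logb 2) := by
  have h1 : entropy ρ = -∑ i, D.r i * Real.logb 2 (D.r i) :=
    (congrArg entropy D.eq_conjDiag).trans (entropy_conjDiag D.isometry_V _)
  have h2 : entropy (reduceB ρ) = -∑ j, D.β j * Real.logb 2 (D.β j) :=
    (congrArg entropy D.reduceB_eq).trans (entropy_conjDiag D.isometry_F _)
  have h3 : D.expect (Real.logb 2) = ∑ i, ∑ q, D.r i * overlap D.V D.W i q * Real.logb 2 (D.r i)
      - ∑ i, ∑ q, D.r i * overlap D.V D.W i q * Real.logb 2 (D.s q) := by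
    rw [expect, jointExp, ← Finset.sum_sub_distrib]
    refine Finset.sum_congr rfl fun i _ => ?_
    rw [← Finset.sum_sub_distrib]
    refine Finset.sum_congr rfl fun q _ => ?_
    by_cases hr : D.r i = 0
    · simp [hr]
    by_cases hs : D.s q = 0
    · simp [D.weight_eq_zero_of_s i q hs]
    · rw [Real.logb_div hr hs]; ring
  have h4 : ∑ i, ∑ q, D.r i * overlap D.V D.W i q * Real.logb 2 (D.r i) =
      ∑ i, D.r i * Real.logb 2 (D.r i) := by
    refine Finset.sum_congr rfl fun i _ => ?_
    rw [← Finset.sum_mul, ← Finset.mul_sum, sum_overlap D.isometry_V D.isometry_W, mul_one]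
  have h5 : ∑ i, ∑ q, D.r i * overlap D.V D.W i q * Real.logb 2 (D.s q) =
      ∑ j, D.β j * Real.logb 2 (D.β j) := by
    rw [Finset.sum_comm, Fintype.sum_prod_type, Finset.sum_comm]
    refine Finset.sum_congr rfl fun j _ => ?_
    rw [← D.sum_weight_B j, Finset.sum_mul]
    refine Finset.sum_congr rfl fun k _ => ?_
    rw [← Finset.sum_mul, D.sum_weight_B j]
    rfl
  rw [condEntropy, h1, h2, h3, h4, h5]
  ring

/-- For each eigenvector `v_i` of `ρ` and each basis vector `e_k` of `A` the operator inequality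
`r_i |v_i⟩⟨v_i| ≤ ρ` bounds the weight of the inverse of `ρ_B` on the component along `e_k`. -/
lemma mul_sum_overlap_div_le_one (i : a × b) (k : a) :
    D.r i * ∑ j, overlap D.V D.W i (k, j) / D.β j ≤ 1 := by
  set U := D.Wᴴ * D.V with hU
  set Q := ∑ j, overlap D.V D.W i (k, j) / D.β j with hQ
  have hQ0 : 0 ≤ Q := Finset.sum_nonneg fun j _ => div_nonneg (overlap_nonneg _ _ _ _)
    (D.β_nonneg j)
  -- The test vector is `g = ρ_B⁻¹ u`, with `u` the component of `v_i` along `e_k`. Then `⟨g, ρ_B g⟩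
  -- = Q` and `⟨u, g⟩ = Q`, so keeping only the term `r_i |⟨u, g⟩|²` of `⟨g, ρ_B g⟩` gives `r_i Q² ≤
  -- Q`.
  set g : b → ℂ := fun j => U (k, j) i / D.β j with hg
  set S : a → a × b → ℂ := fun k' i' => ∑ j, star (U (k', j) i') * g j with hS
  have h1 : ((∑ k', ∑ i', D.r i' * Complex.normSq (S k' i') : ℝ) : ℂ) =
      star g ⬝ᵥ (reduceB (conjDiag U D.r) *ᵥ g) := by
    have e1 : ∀ k' i', (D.r i' : ℂ) * (Complex.normSq (S k' i') : ℂ) =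
        ∑ j, ∑ j', star (g j) * (U (k', j) i' * D.r i' * star (U (k', j') i') * g j') := by
      intro k' i'
      rw [Complex.normSq_eq_conj_mul_self, hS, map_sum, Finset.sum_mul_sum, Finset.mul_sum]
      refine Finset.sum_congr rfl fun j _ => ?_
      rw [Finset.mul_sum]
      refine Finset.sum_congr rfl fun j' _ => ?_
      simp only [map_mul, Complex.star_def, Complex.conj_conj]
      ring
    have e2 : star g ⬝ᵥ (reduceB (conjDiag U D.r) *ᵥ g) = ∑ j, star (g j) *
        ∑ j', (∑ k', ∑ i', U (k', j) i' * D.r i' * star (U (k', j') i')) * g j' := by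
      simp only [dotProduct, mulVec, reduceB, of_apply, conjDiag_apply, Pi.star_apply]
    rw [e2]
    push_cast
    simp only [e1, Finset.sum_mul, Finset.mul_sum]
    exact (Finset.sum_congr rfl fun _ _ => Finset.sum_comm).trans (Finset.sum_comm.trans
      (Finset.sum_congr rfl fun _ _ =>
        (Finset.sum_congr rfl fun _ _ => Finset.sum_comm).trans Finset.sum_comm))
  have h2 : star g ⬝ᵥ (reduceB (conjDiag U D.r) *ᵥ g) = (Q : ℂ) := by
    rw [hU, D.reduceB_conjDiag, dotProduct, hQ]
    push_cast
    refine Finset.sum_congr rfl fun j _ => ?_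
    rw [mulVec_diagonal, overlap, ← hU, Complex.normSq_eq_conj_mul_self, hg]
    simp only [Pi.star_apply, Complex.star_def, map_div₀, Complex.conj_ofReal]
    by_cases h : (D.β j : ℂ) = 0
    · simp [h]
    · field_simp
  have h3 : S k i = (Q : ℂ) := by
    rw [hS, hQ]
    push_cast
    refine Finset.sum_congr rfl fun j _ => ?_
    rw [overlap, ← hU, Complex.normSq_eq_conj_mul_self, hg, Complex.star_def]
    ring
  have h4 : ∑ k', ∑ i', D.r i' * Complex.normSq (S k' i') = Q := by
    rw [h2] at h1
    exact_mod_cast h1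
  have hnn : ∀ k' i', 0 ≤ D.r i' * Complex.normSq (S k' i') := fun k' i' =>
    mul_nonneg (D.r_nonneg i') (Complex.normSq_nonneg _)
  have h5 : D.r i * Complex.normSq (S k i) ≤ Q := by
    rw [← h4]
    exact (Finset.single_le_sum (f := fun i' => D.r i' * Complex.normSq (S k i'))
      (fun i' _ => hnn k i') (Finset.mem_univ i)).trans
      (Finset.single_le_sum (f := fun k' => ∑ i', D.r i' * Complex.normSq (S k' i'))
        (fun k' _ => Finset.sum_nonneg fun i' _ => hnn k' i') (Finset.mem_univ k))
  rw [h3, Complex.normSq_ofReal] at h5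
  rcases hQ0.eq_or_lt with h | h
  · rw [← h, mul_zero]; exact zero_le_one
  · have : D.r i * Q * Q ≤ 1 * Q := by linarith
    exact le_of_mul_le_mul_right this h

lemma sum_ite_α : ∑ k, (if D.α k = 0 then (0 : ℝ) else 1) = ((reduceA ρ).rank : ℝ) := by
  rw [D.rank_eq, Fintype.card_subtype, Finset.card_eq_sum_ones, Finset.sum_filter]
  push_cast
  refine Finset.sum_congr rfl fun k _ => ?_
  by_cases h : D.α k = 0 <;> simp [h]

/-- Only the `k` with `α k ≠ 0` carry weight, and each contributes at most `r_i` for a given `i`.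
Using an eigenbasis of `ρ_A` is what yields the rank instead of the dimension of `A`. -/
lemma expect_id_le : D.expect (fun x => x) ≤ ((reduceA ρ).rank : ℝ) := by
  have h1 : ∀ i, ∑ q, D.r i * overlap D.V D.W i q * (D.r i / D.s q) ≤
      D.r i * ((reduceA ρ).rank : ℝ) := by
    intro i
    rw [← D.sum_ite_α, Fintype.sum_prod_type, Finset.mul_sum]
    refine Finset.sum_le_sum fun k _ => ?_
    by_cases h : D.α k = 0
    · rw [if_pos h, mul_zero]
      refine le_of_eq (Finset.sum_eq_zero fun j _ => ?_)
      rw [D.weight_eq_zero_of_α i (k, j) h, zero_mul]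
    · rw [if_neg h]
      calc ∑ j, D.r i * overlap D.V D.W i (k, j) * (D.r i / D.s (k, j))
          = D.r i * (D.r i * ∑ j, overlap D.V D.W i (k, j) / D.β j) := by
            rw [Finset.mul_sum, Finset.mul_sum]
            refine Finset.sum_congr rfl fun j _ => ?_
            rw [s]
            ring
        _ ≤ D.r i * 1 :=
            mul_le_mul_of_nonneg_left (D.mul_sum_overlap_div_le_one i k) (D.r_nonneg i)
  calc D.expect (fun x => x) ≤ ∑ i, D.r i * ((reduceA ρ).rank : ℝ) :=
        Finset.sum_le_sum fun i _ => h1 i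
    _ = _ := by rw [← Finset.sum_mul, D.sum_r, one_mul]

/-- The factor `r_i` cancels, leaving `β_j` times a sum of transition probabilities over `i`; each
`k` in the support of `ρ_A` then contributes at most `∑ β_j = 1`. -/
lemma expect_inv_le : D.expect (fun x => x⁻¹) ≤ ((reduceA ρ).rank : ℝ) := by
  rw [expect, jointExp, Finset.sum_comm, ← D.sum_ite_α, Fintype.sum_prod_type]
  refine Finset.sum_le_sum fun k _ => ?_
  by_cases h : D.α k = 0
  · rw [if_pos h]
    refine le_of_eq (Finset.sum_eq_zero fun j _ => Finset.sum_eq_zero fun i _ => ?_)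
    rw [D.weight_eq_zero_of_α i (k, j) h, zero_mul]
  · rw [if_neg h, ← D.sum_β]
    refine Finset.sum_le_sum fun j _ => ?_
    calc ∑ i, D.r i * overlap D.V D.W i (k, j) * (D.r i / D.s (k, j))⁻¹
        ≤ ∑ i, D.β j * overlap D.W D.V (k, j) i := by
          refine Finset.sum_le_sum fun i _ => ?_
          rw [overlap_comm D.W D.V]
          have h0 := mul_nonneg (D.β_nonneg j) (overlap_nonneg D.V D.W i (k, j))
          -- Zero eigenvalues of `ρ` contribute nothing on the left but may contribute on the right,
          -- so only an inequality holds.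
          by_cases hr : D.r i = 0
          · simpa [hr] using h0
          · rw [inv_div, s]
            field_simp
            exact le_rfl
      _ = D.β j := by
          rw [← Finset.mul_sum, sum_overlap D.isometry_W D.isometry_V, mul_one]

/-- The single-system entropy contribution is at most `2 √(rank ρ_A) + 1`. -/
theorem entropyContribution_le (D : SpectralData ρ) :
    entropyContribution ρ ≤ 2 * Real.sqrt ((reduceA ρ).rank : ℝ) + 1 := by
  have hnn : ∀ i q, 0 ≤ D.r i / D.s q := fun i q => div_nonneg (D.r_nonneg i) (D.s_nonneg q)
  have h1 : D.expect Real.sqrt ≤ Real.sqrt ((reduceA ρ).rank : ℝ) := by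
    refine (jointExp_le_sqrt D.s D.r_nonneg D.sum_weight _).trans (Real.sqrt_le_sqrt ?_)
    refine le_trans (le_of_eq ?_) D.expect_id_le
    refine Finset.sum_congr rfl fun i _ => Finset.sum_congr rfl fun q _ => ?_
    simp only [Real.sq_sqrt (hnn i q)]
  have h2 : D.expect (fun x => (Real.sqrt x)⁻¹) ≤ Real.sqrt ((reduceA ρ).rank : ℝ) := by
    refine (jointExp_le_sqrt D.s D.r_nonneg D.sum_weight _).trans (Real.sqrt_le_sqrt ?_)
    refine le_trans (le_of_eq ?_) D.expect_inv_le
    refine Finset.sum_congr rfl fun i _ => Finset.sum_congr rfl fun q _ => ?_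
    simp only [inv_pow, Real.sq_sqrt (hnn i q)]
  have h3 : D.expect (fun _ => 1) = 1 := by
    simp only [expect, jointExp, mul_one, D.sum_weight]
  rw [D.entropyContribution_eq, expect, jointExp_add, jointExp_add]
  rw [expect] at h1 h2 h3
  linarith

/-- Bound on the moments of the joint distribution by the conditional entropy. -/
lemma expect_rpow_le {γ t : ℝ} (hγ : entropyContribution ρ ≤ γ) (ht0 : 0 ≤ t) (ht : t ≤ 1 / 5)
    (htγ : (2 * t * Real.log γ) ^ 2 ≤ 1 / 5) :
    D.expect (fun x => x ^ t) ≤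
      Real.exp (-t * Real.log 2 * condEntropy ρ + 11 / 10 * (2 * t * Real.log γ) ^ 2) := by
  have h1 := D.sum_weight
  rw [D.entropyContribution_eq] at hγ
  have hlog : -t * Real.log 2 * condEntropy ρ = t * D.expect Real.log := by
    have h2 : Real.log 2 ≠ 0 := (Real.log_pos one_lt_two).ne'
    have h3 : D.expect Real.log = Real.log 2 * D.expect (Real.logb 2) := by
      simp only [expect, jointExp, Finset.mul_sum, Real.logb]
      refine Finset.sum_congr rfl fun i _ => Finset.sum_congr rfl fun q _ => ?_
      field_simp
    rw [D.condEntropy_eq, h3]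
    ring
  rw [hlog]
  simp only [expect, jointExp, ← Fintype.sum_prod_type'] at h1 hγ ⊢
  refine sum_mul_rpow_le_exp
    (P := fun x : (a × b) × (a × b) => D.r x.1 * overlap D.V D.W x.1 x.2)
    (x := fun x => D.r x.1 / D.s x.2) (fun x => D.weight_nonneg x.1 x.2) h1
    (fun x hx => ?_) hγ ht0 ht htγ
  refine div_pos ((D.r_nonneg _).lt_of_ne' fun h => hx ?_) ((D.s_nonneg _).lt_of_ne' fun h => hx ?_)
  · rw [h, zero_mul]
  · exact D.weight_eq_zero_of_s _ _ h

lemma three_le_entropyContribution (D : SpectralData ρ) : 3 ≤ entropyContribution ρ := by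
  rw [D.entropyContribution_eq, expect, jointExp]
  calc (3 : ℝ) = ∑ i, ∑ q, D.r i * overlap D.V D.W i q * 3 := by
        simp only [← Finset.sum_mul, D.sum_weight, one_mul]
    _ ≤ _ := by
      refine Finset.sum_le_sum fun i _ => Finset.sum_le_sum fun q _ => ?_
      by_cases hr : D.r i = 0
      · simp [hr]
      by_cases hs : D.s q = 0
      · simp [D.weight_eq_zero_of_s i q hs]
      · exact mul_le_mul_of_nonneg_left (three_le_sqrt_add_inv
          (div_pos ((D.r_nonneg _).lt_of_ne' hr) ((D.s_nonneg _).lt_of_ne' hs)))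
          (D.weight_nonneg i q)

end SpectralData

/-! ### Choice of the moment order and conclusion -/

lemma nonempty_left_of_isDensity {a b : Type*} [Fintype a] [Fintype b]
    {ρ : Matrix (a × b) (a × b) ℂ} (hρ : IsDensity ρ) : Nonempty a := by
  by_contra h
  rw [not_nonempty_iff] at h
  have := hρ.2
  rw [Matrix.trace, Finset.univ_eq_empty, Finset.sum_empty] at this
  exact zero_ne_one this

/-- The choice of the order of the moments in the equipartition property. -/
lemma exists_moment_order {n L g : ℝ} (hn : 0 < n) (hL : 0 < L) (hnL : 8 / 5 * L ≤ n)
    (hg : Real.logb 2 3 ≤ g) :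
    ∃ t : ℝ, 0 < t ∧ t ≤ 1 / 5 ∧ (2 * t * (g * Real.log 2)) ^ 2 ≤ 1 / 5 ∧
      n * (11 / 10 * (2 * t * (g * Real.log 2)) ^ 2) + L * Real.log 2 ≤
        t * (4 * g * Real.sqrt L * Real.sqrt n) * Real.log 2 := by
  have h2 := Real.log_two_lt_d9
  have h2' := Real.log_two_gt_d9
  have hg3 : 1.584 ≤ g := by
    refine le_trans ?_ hg
    rw [Real.logb, le_div_iff₀ (by linarith)]
    have := Real.log_three_gt_d9
    linarith
  have hg0 : 0 < g := by linarith
  have hsL := Real.sq_sqrt hL.le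
  have hsn := Real.sq_sqrt hn.le
  have hsL0 := Real.sqrt_pos.2 hL
  have hsn0 := Real.sqrt_pos.2 hn
  set p := Real.sqrt L
  set q := Real.sqrt n
  set w := p / q with hw
  have hw0 : 0 < w := div_pos hsL0 hsn0
  have hpw : p = w * q := by rw [hw]; field_simp
  have hwsq : w ^ 2 ≤ 5 / 8 := by
    rw [hw, div_pow, hsL, hsn, div_le_iff₀ hn]
    linarith
  have hw1 : w ≤ 0.791 := by nlinarith
  -- The error is `(n · 11/10 · (2tg log 2)² + L log 2) / (t log 2)`, so `tg` should scale like `w =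
  -- √(L/n)`. The factor `2/5` is nearly the largest that keeps `t ≤ 1/5` in the extreme case `w² =
  -- 5/8`, `g = log₂ 3`; the claim then needs `11/10 · 16/25 · log 2 + 1 ≤ 8/5`.
  set t := 2 / 5 * w / g with ht
  have htg : t * g = 2 / 5 * w := by rw [ht]; field_simp
  have ht0 : 0 < t := by rw [ht]; positivity
  have hlog : (2 * t * (g * Real.log 2)) ^ 2 = 16 / 25 * w ^ 2 * Real.log 2 ^ 2 := by
    rw [show 2 * t * (g * Real.log 2) = 2 * (t * g) * Real.log 2 by ring, htg]
    ring
  have hl2 : Real.log 2 ^ 2 ≤ 0.49 := by nlinarith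
  refine ⟨t, ht0, ?_, ?_, ?_⟩
  · rw [ht, div_le_iff₀ hg0]
    linarith
  · rw [hlog]
    nlinarith [sq_nonneg w, sq_nonneg (Real.log 2)]
  · rw [hlog, ← hsn, ← hsL, hpw]
    have e : t * (4 * g * (w * q) * q) * Real.log 2 = 8 / 5 * (w ^ 2 * q ^ 2 * Real.log 2) := by
      rw [show t * (4 * g * (w * q) * q) * Real.log 2 =
        4 * (t * g) * (w * q * q) * Real.log 2 by ring, htg]
      ring
    rw [e]
    have h3 : 0 < w ^ 2 * q ^ 2 * Real.log 2 := by positivity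
    nlinarith

/-- The equipartition bound for the smooth min-entropy of a product state. -/
theorem condEntropy_sub_aepError_le_smoothMinEntropy {a b : Type*} [Fintype a] [DecidableEq a]
    [Fintype b] [DecidableEq b] {n : ℕ} (hn : 1 ≤ n) {ρ : Fin n → Matrix (a × b) (a × b) ℂ}
    (hρ : ∀ i, IsDensity (ρ i)) {ε : ℝ} (hε : 0 < ε)
    (hnε : 8 / 5 * Real.logb 2 (2 / ε ^ 2) ≤ (n : ℝ)) {γ : ℝ}
    (hγ : ∀ i, entropyContribution (ρ i) ≤ γ) :
    (((∑ i, condEntropy (ρ i)) - aepError ε γ * Real.sqrt (n : ℝ) : ℝ) : EReal)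
        ≤ smoothMinEntropy ε (productState ρ) := by
  -- For `ε ≥ 1` the smooth min-entropy is infinite, which covers the range where `log₂ (2/ε²)` is
  -- not positive.
  rcases le_or_gt 1 ε with hε1 | hε1
  · rw [smoothMinEntropy_eq_top hε1]
    exact le_top
  have D : ∀ i, SpectralData (ρ i) := fun i => (hρ i).spectralData
  have hγ3 : 3 ≤ γ := (D ⟨0, hn⟩).three_le_entropyContribution.trans (hγ ⟨0, hn⟩)
  have hne : Nonempty a := nonempty_left_of_isDensity (hρ ⟨0, hn⟩)
  have hlog2 : 0 < Real.log 2 := Real.log_pos one_lt_two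
  have hε2 : 1 < 2 / ε ^ 2 := by
    rw [lt_div_iff₀ (by positivity)]
    nlinarith
  set L := Real.logb 2 (2 / ε ^ 2) with hL
  have hL0 : 0 < L := Real.logb_pos one_lt_two hε2
  set g := Real.logb 2 γ with hg
  have hlogγ : Real.log γ = g * Real.log 2 := by
    rw [hg, Real.logb]
    field_simp
  obtain ⟨t, ht0, ht1, ht2, ht3⟩ := exists_moment_order (n := n) (by exact_mod_cast hn) hL0 hnε
    (Real.logb_le_logb_of_le one_lt_two three_pos hγ3)
  set K := ∑ i, condEntropy (ρ i) - aepError ε γ * Real.sqrt (n : ℝ) with hK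
  -- The scale is `l = 2^(-K)`, so that `-log₂ l` is the claimed bound `K`.
  have hl : 0 < Real.exp (-K * Real.log 2) := Real.exp_pos _
  have hε' : ε ^ 2 / 2 = Real.exp (-(L * Real.log 2)) := by
    rw [hL, Real.logb, div_mul_cancel₀ _ hlog2.ne', ← Real.log_inv, inv_div,
      Real.exp_log (by positivity)]
  have hmom : ∏ i, jointExp (D i).V (D i).W (D i).r (D i).s (fun x => x ^ t) ≤
      Real.exp (-K * Real.log 2) ^ t * (ε ^ 2 / 2) := by
    have h0 : ∀ i, 0 ≤ jointExp (D i).V (D i).W (D i).r (D i).s (fun x => x ^ t) := fun i =>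
      Finset.sum_nonneg fun p _ => Finset.sum_nonneg fun q _ => mul_nonneg
        ((D i).weight_nonneg p q)
        (Real.rpow_nonneg (div_nonneg ((D i).r_nonneg p) ((D i).s_nonneg q)) t)
    refine (Finset.prod_le_prod (fun i _ => h0 i) fun i _ =>
      (D i).expect_rpow_le (hγ i) ht0.le ht1 (by rw [hlogγ]; exact ht2)).trans ?_
    rw [← Real.exp_sum, hε', ← Real.exp_mul, ← Real.exp_add, Real.exp_le_exp,
      Finset.sum_add_distrib, ← Finset.mul_sum, Finset.sum_const, Finset.card_univ,
      Fintype.card_fin, nsmul_eq_mul, hlogγ, hK, aepError, ← hg, ← hL]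
    linarith
  have h := neg_logb_le_smoothMinEntropy_productState (fun i => (D i).isometry_V)
    (fun i => (D i).isometry_W) (fun i => (D i).r_nonneg) (fun i => (D i).s_nonneg)
    (fun i => (D i).sum_r) (fun i => (D i).one_kronecker_reduceB)
    (fun i => (trace_reduceB _).trans (hρ i).2) (fun i p q => (D i).weight_eq_zero_of_s p q)
    hε.le hl ht0 (by linarith) hmom
  have hρeq : (fun i => conjDiag (D i).V (D i).r) = ρ := funext fun i => (D i).eq_conjDiag.symm
  rw [hρeq, Real.logb, Real.log_exp, neg_mul, neg_div, neg_neg, mul_div_cancel_right₀ _ hlog2.ne']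
    at h
  exact h

end QEntropy

theorem mainTheorem6 {a b : Type*} [Fintype a] [DecidableEq a] [Fintype b] [DecidableEq b]
    (n : ℕ) (hn : 1 ≤ n) (ρ : Fin n → Matrix (a × b) (a × b) ℂ)
    (hρ : ∀ i, QEntropy.IsDensity (ρ i))
    (ε : ℝ) (hε : 0 < ε) (hnε : 8 / 5 * Real.logb 2 (2 / ε ^ 2) ≤ (n : ℝ))
    (γ : ℝ) (hγ : γ = ⨆ i, QEntropy.entropyContribution (ρ i)) :
    (((∑ i, QEntropy.condEntropy (ρ i)) - QEntropy.aepError ε γ * Real.sqrt (n : ℝ) : ℝ) : EReal)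
        ≤ QEntropy.smoothMinEntropy ε (QEntropy.productState ρ) ∧
      γ ≤ 2 * (⨆ i, Real.sqrt ((QEntropy.reduceA (ρ i)).rank : ℝ)) + 1 := by
  have hbdd : ∀ f : Fin n → ℝ, BddAbove (Set.range f) := fun f => (Set.finite_range f).bddAbove
  refine ⟨QEntropy.condEntropy_sub_aepError_le_smoothMinEntropy hn hρ hε hnε fun i =>
    hγ ▸ le_ciSup (hbdd fun i => QEntropy.entropyContribution (ρ i)) i, ?_⟩
  have : Nonempty (Fin n) := ⟨⟨0, hn⟩⟩
  rw [hγ]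
  refine ciSup_le fun i => (hρ i).spectralData.entropyContribution_le.trans ?_
  have := le_ciSup (hbdd fun i => Real.sqrt ((QEntropy.reduceA (ρ i)).rank : ℝ)) i
  linarith
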